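/- For a positive integer $d$, $j\in\{1,\dots,d\}$, $t>0$ and $f\colon\mathbb{R}^d\to\mathbb{C}$, let \[ R_j^t f(x)=\frac{\Gamma\left(\frac{d+1}{2}\right)}{\pi^{\frac{d+1}{2}}}\int_{|x-y|>t}\frac{x_j-y_j}{|x-y|^{d+1}}\,f(y)\,dy,\qquad x\in\mathbb{R}^d, \] be the $j$-th truncated Riesz transform of $f$, where $|\cdot|$ is the Euclidean norm. Theorem. For each $p\in(1,\infty)$ there exists a constant $C_p>0$, depending only on $p$ (in particular independent of the dimension $d$), such that for every $d\geq 1$ and every $f\in L^p(\mathbb{R}^d)$ the integral defining $R_j^tf(x)$ converges absolutely for all $j\in\{1,\dots,d\}$, $t>0$ and $x\in\mathbb{R}^d$, the function $x\mapsto\sup_{t>0}\bigl(\sum_{j=1}^d|R_j^tf(x)|^2\bigr)^{1/2}$ belongs to $L^p(\mathbb{R}^d)$, and \[ \left\|\sup_{t>0}\left(\sum_{j=1}^d|R_j^tf|^2\right)^{1/2}\right\|_{L^p(\mathbb{R}^d)}\leq C_p\,\|f\|_{L^p(\mathbb{R}^d)}. \] -/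

import Mathlib

open MeasureTheory
open scoped ENNReal

noncomputable section

/-- The integrand `y ↦ (x_j - y_j) / |x - y|^(d+1) * f y` of the Riesz transforms at `x`. -/
def rieszIntegrand {d : ℕ} (j : Fin d) (f : EuclideanSpace ℝ (Fin d) → ℂ)
    (x y : EuclideanSpace ℝ (Fin d)) : ℂ :=
  (((x j - y j) / ‖x - y‖ ^ (d + 1) : ℝ) : ℂ) * f y

/-- The truncated Riesz transform `R_j^t f (x)` on `ℝ^d`. -/
def truncRiesz {d : ℕ} (j : Fin d) (t : ℝ) (f : EuclideanSpace ℝ (Fin d) → ℂ)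
    (x : EuclideanSpace ℝ (Fin d)) : ℂ :=
  ((Real.Gamma (((d : ℝ) + 1) / 2) / Real.pi ^ (((d : ℝ) + 1) / 2) : ℝ) : ℂ) *
    ∫ y in {y | t < ‖x - y‖}, rieszIntegrand j f x y

/-- The maximal function `sup_{t > 0} (∑_j |R_j^t f (x)|^2)^(1/2)`, with values in `[0, ∞]`. -/
def maxTruncRiesz {d : ℕ} (f : EuclideanSpace ℝ (Fin d) → ℂ)
    (x : EuclideanSpace ℝ (Fin d)) : ℝ≥0∞ :=
  ⨆ t : ℝ, ⨆ _ : 0 < t, ENNReal.ofReal (Real.sqrt (∑ j : Fin d, ‖truncRiesz j t f x‖ ^ 2))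

end

namespace DimFreeRiesz

noncomputable section

open Set Filter Topology Metric

/-! ### Layer cake formula for functions with values in `[0, ∞]` -/

/-! The proof is the method of rotations with the constants tracked; `q` is the exponent conjugate
to `p`. Since the Riesz kernel is odd, polar coordinates turn twice the truncated transform in
direction `v` into the integral over the sphere of `⟪v, θ⟫` times the truncated Hilbert transform
along `θ` (`rieszT_eq_average`). Hölder's inequality in `θ` separates the `q`-th moment of `⟪v, ·⟫`
from the `L^p` norm over the sphere of the directional maximal functions. That moment is the same
for all unit `v`, so the supremum over `t` and the euclidean norm over `j`, which is controlled by a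
supremum over `v`, are absorbed pointwise (`maxTruncRiesz_le`). Integrating in `x` and applying
Tonelli leaves the maximal truncated Hilbert transform on the lines parallel to each `θ`.

The dimension enters only through `rieszC d`, the `1/q`-th power of the moment and the `1/p`-th
power of the area of the sphere. Gaussian integrals evaluate both as quotients of Gamma values
(`sphereMoment_eq`, `toSphere_univ_eq`), and log-convexity of Gamma bounds the product independently
of `d` (`rieszC_mul_le`).

The one-dimensional bound is obtained by complex analysis. The truncated kernel differs from the
conjugate Poisson kernel by at most the Poisson kernel (`abs_truncK_sub_conjK_le`), so it suffices
to control the Hardy-Littlewood maximal function and the Cauchy transform on vertical lines. Values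
at height `t` are Poisson averages of values at any lower height (`pi_mul_cauchyT_eq`); hence a
bound on horizontal lines, uniform in the height, is enough (`lintegral_cauchyT_rpow_le`). For `p ≤
2` that bound is M. Riesz' contour argument (`lintegral_cauchyT_rpow_le_poisI`); for `p ≥ 2` it
follows by duality. -/

theorem rpow_eq_lintegral_indicator {p : ℝ} (hp : 0 < p) (y : ℝ≥0∞) :
    y ^ p = ENNReal.ofReal p * ∫⁻ t in Ioi (0 : ℝ),
      {t : ℝ | ENNReal.ofReal t < y}.indicator (fun t => ENNReal.ofReal (t ^ (p - 1))) t := by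
  have fin : ∀ z : ℝ, 0 ≤ z → ENNReal.ofReal (z ^ p) = ENNReal.ofReal p * ∫⁻ t in Ioi (0 : ℝ),
      {t : ℝ | t < z}.indicator (fun t => ENNReal.ofReal (t ^ (p - 1))) t := by
    intro z hz
    -- Under a Dirac mass the layer cake formula becomes an identity for a single number.
    have := lintegral_rpow_eq_lintegral_meas_lt_mul (Measure.dirac (0 : ℝ)) (f := fun _ => z)
      (ae_of_all _ fun _ => hz) measurable_const.aemeasurable hp
    rw [lintegral_dirac] at this
    rw [this]
    congr 1
    refine lintegral_congr fun t => ?_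
    by_cases h : t < z <;> simp [h]
  rcases eq_or_ne y ⊤ with rfl | hy
  · rw [ENNReal.top_rpow_of_pos hp, eq_comm, ← top_le_iff]
    -- At `⊤` the integral dominates its value for every finite level; level `r ^ p⁻¹` yields `r`.
    refine ENNReal.le_of_forall_nnreal_lt fun r _ => ?_
    have h1 := fin ((r : ℝ) ^ p⁻¹) (by positivity)
    rw [← Real.rpow_mul r.coe_nonneg, inv_mul_cancel₀ hp.ne', Real.rpow_one,
      ENNReal.ofReal_coe_nnreal] at h1
    rw [h1]
    gcongr
    exact fun _ => ENNReal.ofReal_lt_top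
  · have h1 := fin y.toReal ENNReal.toReal_nonneg
    rw [← ENNReal.ofReal_rpow_of_nonneg ENNReal.toReal_nonneg hp.le, ENNReal.ofReal_toReal hy] at h1
    rw [h1]
    congr 1
    refine setLIntegral_congr_fun measurableSet_Ioi fun t ht => ?_
    have : ENNReal.ofReal t < y ↔ t < y.toReal :=
      ENNReal.ofReal_lt_iff_lt_toReal (le_of_lt ht) hy
    by_cases h : t < y.toReal <;> simp [h, this]

/-- Tonelli applied to the scalar identity. Values in `ℝ≥0∞` matter: the maximal functions below are
not known to be finite in advance. -/
theorem lintegral_rpow_eq_lintegral_meas_lt {α : Type*} [MeasurableSpace α] (μ : Measure α)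
    [SFinite μ] {f : α → ℝ≥0∞} (hf : Measurable f) {p : ℝ} (hp : 0 < p) :
    ∫⁻ x, f x ^ p ∂μ = ENNReal.ofReal p * ∫⁻ t in Ioi (0 : ℝ),
      μ {x | ENNReal.ofReal t < f x} * ENNReal.ofReal (t ^ (p - 1)) := by
  have hs : MeasurableSet {q : α × ℝ | ENNReal.ofReal q.2 < f q.1} :=
    measurableSet_lt (by fun_prop) (by fun_prop)
  have hm : Measurable fun q : α × ℝ => {q : α × ℝ | ENNReal.ofReal q.2 < f q.1}.indicator
      (fun q => ENNReal.ofReal (q.2 ^ (p - 1))) q := Measurable.indicator (by fun_prop) hs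
  simp_rw [rpow_eq_lintegral_indicator hp]
  rw [lintegral_const_mul]
  swap
  · exact Measurable.lintegral_prod_right' (f := fun q : α × ℝ =>
      {q : α × ℝ | ENNReal.ofReal q.2 < f q.1}.indicator
      (fun q => ENNReal.ofReal (q.2 ^ (p - 1))) q) hm
  congr 1
  rw [lintegral_lintegral_swap hm.aemeasurable]
  refine lintegral_congr fun t => ?_
  have : MeasurableSet {x | ENNReal.ofReal t < f x} := measurableSet_lt measurable_const hf
  rw [mul_comm, ← setLIntegral_const, ← lintegral_indicator this]
  rfl

/-! ### The Hardy-Littlewood maximal function over dyadic radii on the real line -/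

/-- The centred maximal function, with balls of radius `2 ^ k`, normalised by the radius. -/
def dyadicMax (g : ℝ → ℝ≥0∞) (x : ℝ) : ℝ≥0∞ :=
  ⨆ k : ℤ, (∫⁻ y in ball x ((2 : ℝ) ^ k), g y) / ENNReal.ofReal ((2 : ℝ) ^ k)

theorem measurable_lintegral_ball {g : ℝ → ℝ≥0∞} (hg : Measurable g) (r : ℝ) :
    Measurable fun x => ∫⁻ y in ball x r, g y := by
  have hs : MeasurableSet {q : ℝ × ℝ | dist q.2 q.1 < r} :=
    measurableSet_lt (by fun_prop) (by fun_prop)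
  have hm : Measurable fun q : ℝ × ℝ => {q : ℝ × ℝ | dist q.2 q.1 < r}.indicator
      (fun q => g q.2) q := Measurable.indicator (by fun_prop) hs
  have := Measurable.lintegral_prod_right' (ν := volume) hm
  convert this using 2 with x
  rw [← lintegral_indicator measurableSet_ball]
  rfl

theorem measurable_dyadicMax {g : ℝ → ℝ≥0∞} (hg : Measurable g) : Measurable (dyadicMax g) :=
  Measurable.iSup fun _ => (measurable_lintegral_ball hg _).div_const _

theorem lintegral_ball_le_dyadicMax (g : ℝ → ℝ≥0∞) (x : ℝ) (k : ℤ) :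
    ∫⁻ y in ball x ((2 : ℝ) ^ k), g y ≤ ENNReal.ofReal ((2 : ℝ) ^ k) * dyadicMax g x := by
  have h : (∫⁻ y in ball x ((2 : ℝ) ^ k), g y) / ENNReal.ofReal ((2 : ℝ) ^ k) ≤ dyadicMax g x :=
    le_iSup (fun k : ℤ => (∫⁻ y in ball x ((2 : ℝ) ^ k), g y) / ENNReal.ofReal ((2 : ℝ) ^ k)) k
  have hp : (0 : ℝ) < 2 ^ k := by positivity
  rwa [ENNReal.div_le_iff_le_mul (Or.inl (by simpa using hp)) (Or.inl ENNReal.ofReal_ne_top),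
    mul_comm] at h

/-- Weak type (1,1) by Vitali covering: disjoint balls of radius `r` selected from the level set
cover it after enlargement by 5, and an interval of radius `5 * r` has length `10 * r`. -/
theorem volume_dyadicMax_gt_le (g : ℝ → ℝ≥0∞) {l : ℝ} (hl : 0 < l) :
    ENNReal.ofReal l * volume {x | ENNReal.ofReal l < dyadicMax g x} ≤ 10 * ∫⁻ y, g y := by
  rcases eq_or_ne (∫⁻ y, g y) ⊤ with htop | htop
  · simp [htop]
  set A := {x | ENNReal.ofReal l < dyadicMax g x} with hA
  have hex : ∀ x : ℝ, ∃ k : ℤ, x ∈ A →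
      ENNReal.ofReal (l * 2 ^ k) ≤ ∫⁻ y in ball x ((2 : ℝ) ^ k), g y := by
    intro x
    by_cases hx : x ∈ A
    · obtain ⟨k, hk⟩ := lt_iSup_iff.1 (show ENNReal.ofReal l < dyadicMax g x from hx)
      refine ⟨k, fun _ => ?_⟩
      rw [ENNReal.ofReal_mul hl.le]
      have hp : (0 : ℝ) < 2 ^ k := by positivity
      exact ((ENNReal.lt_div_iff_mul_lt (Or.inl (by simpa using hp))
        (Or.inl ENNReal.ofReal_ne_top)).1 hk).le
    · exact ⟨0, fun h => absurd h hx⟩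
  choose k hk using hex
  -- Finiteness of the integral bounds the radii, as the Vitali lemma requires.
  have hbd : ∀ a ∈ A, (2 : ℝ) ^ k a ≤ (∫⁻ y, g y).toReal / l := by
    intro a ha
    rw [le_div_iff₀ hl, mul_comm]
    refine (ENNReal.ofReal_le_iff_le_toReal htop).1 ((hk a ha).trans ?_)
    exact setLIntegral_le_lintegral _ _
  obtain ⟨u, huA, hdisj, hcov⟩ := Vitali.exists_disjoint_subfamily_covering_enlargement_ball
    A id (fun a => (2 : ℝ) ^ k a) _ hbd 5 (by norm_num)
  have hcount : u.Countable := hdisj.countable_of_isOpen (fun _ _ => isOpen_ball)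
    fun a _ => ⟨a, mem_ball_self (by positivity)⟩
  have hsub : A ⊆ ⋃ a ∈ u, ball a (5 * (2 : ℝ) ^ k a) := by
    intro a ha
    obtain ⟨b, hb, hab⟩ := hcov a ha
    exact mem_biUnion hb (hab (mem_ball_self (by positivity)))
  calc ENNReal.ofReal l * volume A
      ≤ ENNReal.ofReal l * ∑' a : u, volume (ball (a : ℝ) (5 * (2 : ℝ) ^ k a)) := by
        gcongr
        exact (measure_mono hsub).trans (measure_biUnion_le _ hcount _)
    _ = ∑' a : u, 10 * ENNReal.ofReal (l * 2 ^ k a) := by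
        rw [← ENNReal.tsum_mul_left]
        congr 1 with a
        rw [Real.volume_ball, ← ENNReal.ofReal_mul hl.le,
          show (10 : ℝ≥0∞) = ENNReal.ofReal 10 by norm_num, ← ENNReal.ofReal_mul (by norm_num)]
        congr 1
        ring
    _ ≤ ∑' a : u, 10 * ∫⁻ y in ball (a : ℝ) ((2 : ℝ) ^ k a), g y := by
        gcongr with a
        exact hk a (huA a.2)
    _ = 10 * ∫⁻ y in ⋃ a ∈ u, ball a ((2 : ℝ) ^ k a), g y := by
        have := lintegral_biUnion (μ := volume) hcount (s := fun a => ball a ((2 : ℝ) ^ k a))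
          (fun _ _ => measurableSet_ball) hdisj g
        rw [ENNReal.tsum_mul_left, this]
    _ ≤ 10 * ∫⁻ y, g y := by gcongr; exact Measure.restrict_le_self

/-- The 2 appears because integrals are divided by the radius and not by the length of the interval.
-/
theorem dyadicMax_le_add (g h : ℝ → ℝ≥0∞) (c : ℝ≥0∞) (hgh : ∀ y, g y ≤ h y + c) (x : ℝ) :
    dyadicMax g x ≤ dyadicMax h x + 2 * c := by
  refine iSup_le fun k => ?_
  have hp : (0 : ℝ) < 2 ^ k := by positivity
  rw [ENNReal.div_le_iff_le_mul (Or.inl (by simpa using hp)) (Or.inl ENNReal.ofReal_ne_top),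
    mul_comm]
  calc ∫⁻ y in ball x ((2 : ℝ) ^ k), g y
      ≤ ∫⁻ y in ball x ((2 : ℝ) ^ k), (h y + c) := lintegral_mono hgh
    _ = (∫⁻ y in ball x ((2 : ℝ) ^ k), h y) + c * ENNReal.ofReal (2 * 2 ^ k) := by
        rw [lintegral_add_right _ measurable_const, setLIntegral_const, Real.volume_ball]
    _ ≤ ENNReal.ofReal ((2 : ℝ) ^ k) * dyadicMax h x + c * ENNReal.ofReal (2 * 2 ^ k) := by
        gcongr
        exact lintegral_ball_le_dyadicMax h x k
    _ = _ := by
        rw [ENNReal.ofReal_mul (by norm_num), ENNReal.ofReal_ofNat]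
        ring

/-- The part of `g` below `t / 4` adds at most `t / 2` to the maximal function, so the weak type
bound can be applied to the remaining part at level `t / 2`. -/
theorem volume_dyadicMax_gt_le_truncated (g : ℝ → ℝ≥0∞) {t : ℝ} (ht : 0 < t) :
    volume {x | ENNReal.ofReal t < dyadicMax g x} ≤ ENNReal.ofReal (20 * t⁻¹) *
      ∫⁻ y, {y | ENNReal.ofReal t < 4 * g y}.indicator g y := by
  set h : ℝ → ℝ≥0∞ := {y | ENNReal.ofReal t < 4 * g y}.indicator g with hh
  have h1 : ∀ y, g y ≤ h y + ENNReal.ofReal (t / 4) := by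
    intro y
    by_cases hy : ENNReal.ofReal t < 4 * g y
    · rw [hh, indicator_of_mem (by exact hy)]
      exact le_self_add
    · refine le_add_left ?_
      rw [ENNReal.ofReal_div_of_pos (by norm_num), ENNReal.le_div_iff_mul_le (by simp) (by simp),
        mul_comm]
      simpa using hy
  have hsub : {x | ENNReal.ofReal t < dyadicMax g x} ⊆
      {x | ENNReal.ofReal (t / 2) < dyadicMax h x} := by
    intro x hx
    have h2 := lt_of_lt_of_le hx (dyadicMax_le_add g h _ h1 x)
    by_contra hcon
    have hcon : dyadicMax h x ≤ ENNReal.ofReal (t / 2) := not_lt.1 hcon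
    refine absurd h2 (not_lt.2 ?_)
    calc dyadicMax h x + 2 * ENNReal.ofReal (t / 4)
        ≤ ENNReal.ofReal (t / 2) + 2 * ENNReal.ofReal (t / 4) := by gcongr
      _ = ENNReal.ofReal t := by
        rw [show (2 : ℝ≥0∞) = ENNReal.ofReal 2 by norm_num, ← ENNReal.ofReal_mul (by norm_num),
          ← ENNReal.ofReal_add (by positivity) (by positivity)]
        congr 1
        ring
  have h3 := volume_dyadicMax_gt_le h (half_pos ht)
  calc volume {x | ENNReal.ofReal t < dyadicMax g x}
      ≤ volume {x | ENNReal.ofReal (t / 2) < dyadicMax h x} := measure_mono hsub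
    _ = ENNReal.ofReal (2 * t⁻¹) * (ENNReal.ofReal (t / 2) *
          volume {x | ENNReal.ofReal (t / 2) < dyadicMax h x}) := by
        rw [← mul_assoc, ← ENNReal.ofReal_mul (by positivity)]
        rw [show 2 * t⁻¹ * (t / 2) = 1 by field_simp]
        simp
    _ ≤ ENNReal.ofReal (2 * t⁻¹) * (10 * ∫⁻ y, h y) := by gcongr
    _ = _ := by
        rw [← mul_assoc, show (10 : ℝ≥0∞) = ENNReal.ofReal 10 by norm_num,
          ← ENNReal.ofReal_mul (by positivity)]
        congr 2
        ring

/-- The maximal function is bounded on `L^p` for `p > 1`. -/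
theorem lintegral_dyadicMax_rpow_le {p : ℝ} (hp : 1 < p) {g : ℝ → ℝ≥0∞} (hg : Measurable g) :
    ∫⁻ x, dyadicMax g x ^ p ≤
      ENNReal.ofReal (20 * p * 4 ^ (p - 1) / (p - 1)) * ∫⁻ x, g x ^ p := by
  have hp1 : 0 < p - 1 := by linarith
  have hs : MeasurableSet {q : ℝ × ℝ | ENNReal.ofReal q.1 < 4 * g q.2} :=
    measurableSet_lt (by fun_prop) (by fun_prop)
  have hm : Measurable fun q : ℝ × ℝ => {q : ℝ × ℝ | ENNReal.ofReal q.1 < 4 * g q.2}.indicator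
      (fun q => g q.2 * ENNReal.ofReal (q.1 ^ (p - 1 - 1))) q :=
    Measurable.indicator (by fun_prop) hs
  calc ∫⁻ x, dyadicMax g x ^ p
      = ENNReal.ofReal p * ∫⁻ t in Ioi (0 : ℝ),
          volume {x | ENNReal.ofReal t < dyadicMax g x} * ENNReal.ofReal (t ^ (p - 1)) :=
        lintegral_rpow_eq_lintegral_meas_lt _ (measurable_dyadicMax hg) (by linarith)
    _ ≤ ENNReal.ofReal p * ∫⁻ t in Ioi (0 : ℝ), 20 * ∫⁻ y,
          {q : ℝ × ℝ | ENNReal.ofReal q.1 < 4 * g q.2}.indicator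
            (fun q => g q.2 * ENNReal.ofReal (q.1 ^ (p - 1 - 1))) (t, y) := by
        refine mul_le_mul_right (setLIntegral_mono' measurableSet_Ioi fun t ht => ?_) _
        have ht : 0 < t := ht
        calc volume {x | ENNReal.ofReal t < dyadicMax g x} * ENNReal.ofReal (t ^ (p - 1))
            ≤ (ENNReal.ofReal (20 * t⁻¹) *
              ∫⁻ y, {y | ENNReal.ofReal t < 4 * g y}.indicator g y) *
                ENNReal.ofReal (t ^ (p - 1)) := by
              gcongr
              exact volume_dyadicMax_gt_le_truncated g ht
          _ = 20 * ((∫⁻ y, {y | ENNReal.ofReal t < 4 * g y}.indicator g y) *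
                ENNReal.ofReal (t ^ (p - 1 - 1))) := by
              rw [Real.rpow_sub_one ht.ne' (p - 1), div_eq_mul_inv,
                ENNReal.ofReal_mul (by positivity), ENNReal.ofReal_mul (by positivity),
                ENNReal.ofReal_ofNat]
              ring
          _ = _ := by
              rw [← lintegral_mul_const]
              · congr 1
                refine lintegral_congr fun y => ?_
                by_cases h : ENNReal.ofReal t < 4 * g y <;> simp [h]
              · exact hg.indicator (measurableSet_lt (by fun_prop) (by fun_prop))
    _ = ENNReal.ofReal p * (20 * ∫⁻ y, ∫⁻ t in Ioi (0 : ℝ),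
          {q : ℝ × ℝ | ENNReal.ofReal q.1 < 4 * g q.2}.indicator
            (fun q => g q.2 * ENNReal.ofReal (q.1 ^ (p - 1 - 1))) (t, y)) := by
        rw [lintegral_const_mul _ hm.lintegral_prod_right', lintegral_lintegral_swap]
        exact hm.aemeasurable
    _ = ENNReal.ofReal p * (20 * ∫⁻ y, ENNReal.ofReal (4 ^ (p - 1) / (p - 1)) * g y ^ p) := by
        congr 2
        refine lintegral_congr fun y => ?_
        -- The scalar layer cake identity with exponent `p - 1`, read backwards, evaluates the
        -- integral in `t`; this is where `1 < p` is essential.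
        have h1 := rpow_eq_lintegral_indicator hp1 (4 * g y)
        calc ∫⁻ t in Ioi (0 : ℝ), {q : ℝ × ℝ | ENNReal.ofReal q.1 < 4 * g q.2}.indicator
              (fun q => g q.2 * ENNReal.ofReal (q.1 ^ (p - 1 - 1))) (t, y)
            = ∫⁻ t in Ioi (0 : ℝ), g y * {t : ℝ | ENNReal.ofReal t < 4 * g y}.indicator
                (fun t => ENNReal.ofReal (t ^ (p - 1 - 1))) t := by
              refine lintegral_congr fun t => ?_
              by_cases h : ENNReal.ofReal t < 4 * g y <;> simp [h]
          _ = g y * (ENNReal.ofReal (p - 1)⁻¹ * (4 * g y) ^ (p - 1)) := by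
              rw [lintegral_const_mul]
              · rw [h1, ← mul_assoc (ENNReal.ofReal (p - 1)⁻¹), ← ENNReal.ofReal_mul (by positivity),
                  inv_mul_cancel₀ hp1.ne', ENNReal.ofReal_one, one_mul]
              · exact Measurable.indicator (by fun_prop)
                  (measurableSet_lt (by fun_prop) (by fun_prop))
          _ = _ := by
              rw [ENNReal.mul_rpow_of_nonneg _ _ hp1.le, div_eq_mul_inv,
                ENNReal.ofReal_mul (by positivity), ← ENNReal.ofReal_rpow_of_pos (by norm_num),
                ENNReal.ofReal_ofNat]
              have : g y ^ p = g y * g y ^ (p - 1) := by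
                conv_lhs => rw [show p = 1 + (p - 1) by ring]
                rw [ENNReal.rpow_add_of_nonneg _ _ zero_le_one hp1.le, ENNReal.rpow_one]
              rw [this]
              ring
    _ = _ := by
        rw [lintegral_const_mul _ (by fun_prop), ← mul_assoc, ← mul_assoc,
          show (20 : ℝ≥0∞) = ENNReal.ofReal 20 by norm_num, ← ENNReal.ofReal_mul (by positivity),
          ← ENNReal.ofReal_mul (by positivity)]
        congr 2
        ring

/-! ### Poisson averages are controlled by the maximal function -/

/-- The kernel is at most `1 / (4 ^ n * T)` on the shell `2 ^ n * T ≤ |r| < 2 ^ (n + 1) * T`, so the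
term of the first ball containing `r` already suffices. -/
theorem poisson_le_tsum_indicator {T : ℝ} (hT : 0 < T) (r : ℝ) :
    ENNReal.ofReal (T / (r ^ 2 + T ^ 2)) ≤ ∑' n : ℕ, ENNReal.ofReal (4 / T * (1 / 4) ^ n) *
      (ball (0 : ℝ) (2 ^ (n + 1) * T)).indicator 1 r := by
  have hex : ∃ n : ℕ, |r| < 2 ^ (n + 1) * T := by
    obtain ⟨n, hn⟩ := pow_unbounded_of_one_lt (|r| / T) (one_lt_two)
    refine ⟨n, ?_⟩
    rw [div_lt_iff₀ hT] at hn
    refine hn.trans_le ?_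
    gcongr <;> norm_num
  classical
  set n := Nat.find hex with hn
  have h1 : |r| < 2 ^ (n + 1) * T := Nat.find_spec hex
  refine le_trans ?_ (ENNReal.le_tsum n)
  rw [indicator_of_mem (by simpa using h1), Pi.one_apply, mul_one]
  refine ENNReal.ofReal_le_ofReal ?_
  rw [div_le_iff₀ (by positivity)]
  rcases Nat.eq_zero_or_pos n with h0 | h0
  · rw [h0, pow_zero, mul_one, div_mul_eq_mul_div, le_div_iff₀ hT]
    nlinarith [sq_nonneg r]
  · have h2 : 2 ^ n * T ≤ |r| := by
      have := Nat.find_min hex (m := n - 1) (by omega)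
      rw [Nat.sub_add_cancel h0] at this
      exact not_lt.1 this
    have h3 : (2 ^ n * T) ^ 2 ≤ r ^ 2 := by
      rw [← sq_abs r]
      gcongr
    have h4 : (2 ^ n * T) ^ 2 = 4 ^ n * T ^ 2 := by
      rw [mul_pow, ← pow_mul, mul_comm n 2, pow_mul]
      norm_num
    calc T ≤ 4 / T * (1 / 4) ^ n * (4 ^ n * T ^ 2) := by
          have : (1 / 4 : ℝ) ^ n * 4 ^ n = 1 := by rw [← mul_pow]; norm_num
          calc T ≤ 4 * T := by linarith
            _ = 4 / T * T ^ 2 * ((1 / 4 : ℝ) ^ n * 4 ^ n) := by rw [this]; field_simp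
            _ = _ := by ring
      _ ≤ _ := by
          gcongr
          nlinarith [sq_nonneg T]

theorem lintegral_poisson_le_dyadicMax {g : ℝ → ℝ≥0∞} (hg : Measurable g) {t : ℝ} (ht : 0 < t)
    (x : ℝ) :
    ∫⁻ y, ENNReal.ofReal (t / ((x - y) ^ 2 + t ^ 2)) * g y ≤ 64 * dyadicMax g x := by
  -- Rounding `t` up to a power of two, `t ≤ T < 2 * t`, costs a factor 4 in the kernel and makes
  -- all radii dyadic. The series then sums to 16, whence `64 = 4 * 16`.
  obtain ⟨m, hm1, hm2⟩ := exists_mem_Ioc_zpow ht (one_lt_two (α := ℝ))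
  set T : ℝ := 2 ^ (m + 1) with hT
  have hT0 : 0 < T := by positivity
  have hT2 : T = 2 * 2 ^ m := by rw [hT, zpow_add_one₀ (by norm_num)]; ring
  have hk : ∀ r : ℝ, t / (r ^ 2 + t ^ 2) ≤ 4 * (T / (r ^ 2 + T ^ 2)) := by
    intro r
    rw [← mul_div_assoc, div_le_div_iff₀ (by positivity) (by positivity)]
    have : T < 2 * t := by linarith
    have : T * T ≤ 4 * (T * t) := by nlinarith
    nlinarith [sq_nonneg r]
  calc ∫⁻ y, ENNReal.ofReal (t / ((x - y) ^ 2 + t ^ 2)) * g y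
      ≤ ∫⁻ y, 4 * ∑' n : ℕ, ENNReal.ofReal (4 / T * (1 / 4) ^ n) *
          (ball x (2 ^ (n + 1) * T)).indicator g y := by
        refine lintegral_mono fun y => ?_
        calc ENNReal.ofReal (t / ((x - y) ^ 2 + t ^ 2)) * g y
            ≤ ENNReal.ofReal (4 * (T / ((x - y) ^ 2 + T ^ 2))) * g y := by
              gcongr
              exact hk _
          _ ≤ (4 * ∑' n : ℕ, ENNReal.ofReal (4 / T * (1 / 4) ^ n) *
              (ball (0 : ℝ) (2 ^ (n + 1) * T)).indicator 1 (x - y)) * g y := by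
              gcongr
              rw [ENNReal.ofReal_mul (by norm_num), ENNReal.ofReal_ofNat]
              gcongr
              exact poisson_le_tsum_indicator hT0 _
          _ = _ := by
              rw [mul_assoc, ← ENNReal.tsum_mul_right]
              congr 2 with n
              rw [mul_assoc]
              congr 1
              have hiff : x - y ∈ ball (0 : ℝ) (2 ^ (n + 1) * T) ↔
                  y ∈ ball x (2 ^ (n + 1) * T) := by
                simp [Real.dist_eq, abs_sub_comm]
              by_cases h : y ∈ ball x (2 ^ (n + 1) * T)
              · rw [indicator_of_mem (hiff.2 h), indicator_of_mem h]; simp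
              · rw [indicator_of_notMem (fun h' => h (hiff.1 h')), indicator_of_notMem h]; simp
    _ = 4 * ∑' n : ℕ, ENNReal.ofReal (4 / T * (1 / 4) ^ n) *
          ∫⁻ y in ball x (2 ^ (n + 1) * T), g y := by
        have hmi : ∀ n : ℕ, Measurable fun y =>
            (ball x (2 ^ (n + 1) * T)).indicator g y := fun n => hg.indicator measurableSet_ball
        rw [lintegral_const_mul _ (Measurable.tsum fun n => (hmi n).const_mul _),
          lintegral_tsum fun n => ((hmi n).const_mul _).aemeasurable]
        congr 2 with n
        rw [lintegral_const_mul _ (hmi n), lintegral_indicator measurableSet_ball]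
    _ ≤ 4 * ∑' n : ℕ, ENNReal.ofReal (8 * (1 / 2) ^ n) * dyadicMax g x := by
        refine mul_le_mul_right (ENNReal.tsum_le_tsum fun n => ?_) _
        have e : (2 : ℝ) ^ (n + 1) * T = 2 ^ ((n : ℤ) + 1 + (m + 1)) := by
          rw [zpow_add₀ (by norm_num), hT]
          norm_cast
        calc ENNReal.ofReal (4 / T * (1 / 4) ^ n) * ∫⁻ y in ball x (2 ^ (n + 1) * T), g y
            ≤ ENNReal.ofReal (4 / T * (1 / 4) ^ n) *
                (ENNReal.ofReal (2 ^ (n + 1) * T) * dyadicMax g x) := by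
              gcongr
              rw [e]
              exact lintegral_ball_le_dyadicMax _ _ _
          _ = _ := by
              rw [← mul_assoc, ← ENNReal.ofReal_mul (by positivity)]
              congr 2
              have : (1 / 4 : ℝ) ^ n * 2 ^ n = (1 / 2) ^ n := by rw [← mul_pow]; norm_num
              rw [← this]
              field_simp
              ring
    _ = 64 * dyadicMax g x := by
        rw [ENNReal.tsum_mul_right, ← ENNReal.ofReal_tsum_of_nonneg (fun n => by positivity)
          ((summable_geometric_two).mul_left 8), tsum_mul_left, tsum_geometric_two, ← mul_assoc]
        congr 1
        rw [show (4 : ℝ≥0∞) = ENNReal.ofReal 4 by norm_num, ← ENNReal.ofReal_mul (by norm_num)]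
        norm_num

/-! ### Cauchy's theorem on a half-plane -/

theorem one_add_rpow_neg_le {R s a : ℝ} (hR : 0 < R) (hs : R ≤ s) (ha : 0 < a) :
    (1 + s) ^ (-a) ≤ R ^ (-a) :=
  Real.rpow_le_rpow_of_nonpos hR (by linarith) (by linarith)

theorem integrable_of_norm_le_one_add {E : Type*} [NormedAddCommGroup E] {f : ℝ → E} {C a : ℝ}
    (ha : 1 < a) (hf : AEStronglyMeasurable f volume)
    (h : ∀ x, ‖f x‖ ≤ C * (1 + |x|) ^ (-a)) : Integrable f := by
  have h1 : Integrable fun x : ℝ => (1 + ‖x‖) ^ (-a) :=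
    integrable_one_add_norm (by simpa using ha)
  refine (h1.const_mul C).mono' hf (ae_of_all _ fun x => ?_)
  simpa [Real.norm_eq_abs] using h x

/-- The integral over a horizontal line of a function which is holomorphic and decays above it. -/
theorem integral_horizontal_eq_zero {G : ℂ → ℂ} {ε C a : ℝ} (hε : 0 < ε) (ha : 1 < a)
    (hG : DifferentiableOn ℂ G {z | ε ≤ z.im})
    (hdec : ∀ z : ℂ, ε ≤ z.im → ‖G z‖ ≤ C * (1 + ‖z‖) ^ (-a)) :
    ∫ x : ℝ, G (x + ε * Complex.I) = 0 := by
  have hC : 0 ≤ C := by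
    have h1 := (norm_nonneg _).trans (hdec (ε * Complex.I) (by simp))
    by_contra hneg
    have : 0 < (1 + ‖(ε : ℂ) * Complex.I‖) ^ (-a) := by positivity
    nlinarith [mul_pos_of_neg_of_neg (not_le.1 hneg) (neg_neg_of_pos this)]
  have hint : Integrable fun x : ℝ => G (x + ε * Complex.I) := by
    refine integrable_of_norm_le_one_add (C := C) ha ?_ fun x => ?_
    · refine Continuous.aestronglyMeasurable ?_
      refine hG.continuousOn.comp_continuous (by fun_prop) fun x => ?_
      simp
    · refine (hdec _ (by simp)).trans ?_
      gcongr C * ?_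
      refine Real.rpow_le_rpow_of_nonpos (by positivity) ?_ (by linarith)
      gcongr
      simpa using Complex.abs_re_le_norm (x + ε * Complex.I)
  have hlim := intervalIntegral_tendsto_integral hint tendsto_neg_atTop_atBot tendsto_id
  refine tendsto_nhds_unique hlim ?_
  -- Cauchy's theorem on the rectangle of half-width and height `R`: the other three sides have
  -- total length `4 * R`, and the integrand is at most `C * R ^ (-a)` there.
  have hbound : ∀ R : ℝ, 0 < R →
      ‖∫ x in (-R)..R, G (x + ε * Complex.I)‖ ≤ 4 * C * R ^ (1 - a) := by
    intro R hR
    have hB : ∀ z : ℂ, ε ≤ z.im → R ≤ ‖z‖ → ‖G z‖ ≤ C * R ^ (-a) := fun z h1 h2 =>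
      (hdec z h1).trans (mul_le_mul_of_nonneg_left (one_add_rpow_neg_le hR h2 (by linarith)) hC)
    have hrect := Complex.integral_boundary_rect_eq_zero_of_differentiableOn G
      (⟨-R, ε⟩ : ℂ) (⟨R, ε + R⟩ : ℂ) (hG.mono fun z hz => by
        have := hz.2
        simp only [mem_preimage, uIcc_of_le (show ε ≤ ε + R by linarith)] at this
        exact this.1)
    simp only at hrect
    have e1 : ‖∫ x in (-R)..R, G (x + (ε + R : ℝ) * Complex.I)‖ ≤ C * R ^ (-a) * |R - -R| := by
      refine intervalIntegral.norm_integral_le_of_norm_le_const fun x _ => hB _ ?_ ?_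
      · simp [hR.le]
      · have := Complex.abs_im_le_norm (x + (ε + R : ℝ) * Complex.I)
        simp only [Complex.add_im, Complex.ofReal_im, Complex.mul_im, Complex.ofReal_re,
          Complex.I_im, mul_one, Complex.I_re, mul_zero, add_zero, zero_add] at this
        exact (by linarith [le_abs_self (ε + R)] : R ≤ |ε + R|).trans this
    have e2 : ∀ s : ℝ, |s| = R →
        ‖∫ y in ε..(ε + R), G ((s : ℝ) + y * Complex.I)‖ ≤ C * R ^ (-a) * |ε + R - ε| := by
      intro s hs
      refine intervalIntegral.norm_integral_le_of_norm_le_const fun y hy => hB _ ?_ ?_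
      · rw [uIoc_of_le (by linarith)] at hy
        simpa using hy.1.le
      · have := Complex.abs_re_le_norm (s + y * Complex.I)
        simp only [Complex.add_re, Complex.ofReal_re, Complex.mul_re, Complex.I_re, mul_zero,
          Complex.ofReal_im, Complex.I_im, mul_one, sub_zero, add_zero] at this
        rwa [hs] at this
    have e2a := e2 R (abs_of_pos hR)
    have e2b := e2 (-R) (by rw [abs_neg, abs_of_pos hR])
    have hsolve : ∫ x in (-R)..R, G (x + ε * Complex.I) =
        (∫ x in (-R)..R, G (x + (ε + R : ℝ) * Complex.I))
        - Complex.I • (∫ y in ε..(ε + R), G ((R : ℝ) + y * Complex.I))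
        + Complex.I • (∫ y in ε..(ε + R), G ((-R : ℝ) + y * Complex.I)) := by
      linear_combination hrect
    rw [hsolve]
    have hR1 : R ^ (1 - a) = R * R ^ (-a) := by
      rw [sub_eq_add_neg, Real.rpow_add hR, Real.rpow_one]
    rw [show R - -R = 2 * R by ring, abs_of_pos (by linarith)] at e1
    rw [show ε + R - ε = R by ring, abs_of_pos hR] at e2a e2b
    refine (norm_add_le _ _).trans ((add_le_add_left (norm_sub_le _ _) _).trans ?_)
    rw [norm_smul, norm_smul, Complex.norm_I, one_mul, one_mul, hR1]
    linarith
  have hz : Tendsto (fun R : ℝ => 4 * C * R ^ (1 - a)) atTop (𝓝 0) := by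
    have := (tendsto_rpow_neg_atTop (show 0 < a - 1 by linarith)).const_mul (4 * C)
    rw [mul_zero] at this
    exact this.congr fun R => by rw [neg_sub]
  refine squeeze_zero_norm' ?_ hz
  filter_upwards [eventually_gt_atTop 0] with R hR using hbound R hR

section

/-! ### Poisson and conjugate Poisson integrals, and the Cauchy transform -/

/-- Bounded measurable functions of bounded support on the line. -/
structure BddCpt (g : ℝ → ℝ) : Prop where
  meas : Measurable g
  bdd : ∃ B, ∀ x, |g x| ≤ B
  cpt : ∃ N, ∀ x, N < |x| → g x = 0

theorem BddCpt.integrable {g : ℝ → ℝ} (hg : BddCpt g) : Integrable g := by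
  obtain ⟨B, hB⟩ := hg.bdd
  obtain ⟨N, hN⟩ := hg.cpt
  have hsub : Function.support g ⊆ Icc (-N) N := by
    intro x hx
    by_contra h
    refine hx (hN x (not_le.1 fun h' => h (abs_le.1 h')))
  rw [← integrableOn_iff_integrable_of_support_subset hsub]
  exact Measure.integrableOn_of_bounded measure_Icc_lt_top.ne hg.meas.aestronglyMeasurable
    (M := B) (ae_of_all _ fun x => by simpa using hB x)

/-- The Poisson kernel, up to the factor `π`. -/
def poisK (ε r : ℝ) : ℝ := ε / (r ^ 2 + ε ^ 2)

/-- The conjugate Poisson kernel, up to the factor `π`. -/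
def conjK (ε r : ℝ) : ℝ := r / (r ^ 2 + ε ^ 2)

/-- The Poisson integral, up to the factor `π`. -/
def poisI (ε : ℝ) (g : ℝ → ℝ) (x : ℝ) : ℝ := ∫ s, poisK ε (x - s) * g s

/-- The conjugate Poisson integral, up to the factor `π`. -/
def conjI (ε : ℝ) (g : ℝ → ℝ) (x : ℝ) : ℝ := ∫ s, conjK ε (x - s) * g s

/-- The Cauchy transform. -/
def cauchyT (g : ℝ → ℝ) (z : ℂ) : ℂ := ∫ s : ℝ, (g s : ℂ) / (z - s)

@[fun_prop] theorem measurable_poisK (ε : ℝ) : Measurable (poisK ε) := by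
  unfold poisK; fun_prop

@[fun_prop] theorem measurable_conjK (ε : ℝ) : Measurable (conjK ε) := by
  unfold conjK; fun_prop

theorem poisK_pos {ε : ℝ} (hε : 0 < ε) (r : ℝ) : 0 < poisK ε r := by
  unfold poisK; positivity

theorem poisK_le {ε : ℝ} (hε : 0 < ε) (r : ℝ) : poisK ε r ≤ 1 / ε := by
  unfold poisK
  rw [div_le_div_iff₀ (by positivity) hε]
  nlinarith [sq_nonneg r]

theorem abs_conjK_le {ε : ℝ} (hε : 0 < ε) (r : ℝ) : |conjK ε r| ≤ 1 / ε := by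
  unfold conjK
  rw [abs_div, abs_of_pos (show 0 < r ^ 2 + ε ^ 2 by positivity),
    div_le_div_iff₀ (by positivity) hε, ← sq_abs r]
  nlinarith [sq_nonneg (|r| - ε), abs_nonneg r, sq_nonneg |r|, sq_nonneg ε]

theorem conjK_neg (ε r : ℝ) : conjK ε (-r) = -conjK ε r := by
  unfold conjK; rw [neg_sq, neg_div]

variable {g : ℝ → ℝ}

theorem integrable_poisK_mul (hg : Integrable g) {ε : ℝ} (hε : 0 < ε) (x : ℝ) :
    Integrable fun s => poisK ε (x - s) * g s :=
  hg.bdd_mul (c := 1 / ε) (Measurable.aestronglyMeasurable (by fun_prop)) (ae_of_all _ fun s => by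
    rw [Real.norm_eq_abs, abs_of_pos (poisK_pos hε _)]; exact poisK_le hε _)

theorem integrable_conjK_mul (hg : Integrable g) {ε : ℝ} (hε : 0 < ε) (x : ℝ) :
    Integrable fun s => conjK ε (x - s) * g s :=
  hg.bdd_mul (c := 1 / ε) (Measurable.aestronglyMeasurable (by fun_prop)) (ae_of_all _ fun s => abs_conjK_le hε _)

theorem cauchyKernel_eq {ε : ℝ} (hε : 0 < ε) (x s c : ℝ) :
    (c : ℂ) / (x + ε * Complex.I - s) =
      ((conjK ε (x - s) * c : ℝ) : ℂ) - ((poisK ε (x - s) * c : ℝ) : ℂ) * Complex.I := by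
  have hD : ((x : ℂ) - s) ^ 2 + (ε : ℂ) ^ 2 ≠ 0 := by
    have : (x - s) ^ 2 + ε ^ 2 ≠ 0 := by positivity
    exact_mod_cast this
  have hz : (x : ℂ) + ε * Complex.I - s ≠ 0 := by
    intro h
    have := congrArg Complex.im h
    simp at this
    exact hε.ne' this
  rw [div_eq_iff hz]
  unfold conjK poisK
  push_cast
  field_simp
  linear_combination (c : ℂ) * ε ^ 2 * Complex.I_sq

theorem cauchyT_eq (hg : Integrable g) {ε : ℝ} (hε : 0 < ε) (x : ℝ) :
    cauchyT g (x + ε * Complex.I) = (conjI ε g x : ℂ) - (poisI ε g x : ℂ) * Complex.I := by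
  unfold cauchyT conjI poisI
  simp_rw [cauchyKernel_eq hε]
  rw [integral_sub (integrable_conjK_mul hg hε x).ofReal
    ((integrable_poisK_mul hg hε x).ofReal.mul_const _), integral_mul_const,
    integral_complex_ofReal, integral_complex_ofReal]

theorem poisI_eq_im (hg : Integrable g) {ε : ℝ} (hε : 0 < ε) (x : ℝ) :
    poisI ε g x = -(cauchyT g (x + ε * Complex.I)).im := by
  simp [cauchyT_eq hg hε]

theorem im_le_norm_sub (z : ℂ) (s : ℝ) : z.im ≤ ‖z - s‖ := by
  have := (le_abs_self _).trans (Complex.abs_im_le_norm (z - s))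
  simpa using this

theorem differentiableOn_cauchyT (hg : Integrable g) :
    DifferentiableOn ℂ (cauchyT g) {z | 0 < z.im} := by
  intro z₀ hz₀
  have hz₀ : 0 < z₀.im := hz₀
  set δ := z₀.im / 2 with hδ
  have hδ0 : 0 < δ := by positivity
  have him : ∀ z ∈ {z : ℂ | δ < z.im}, ∀ s : ℝ, δ < ‖z - s‖ := fun z hz s =>
    lt_of_lt_of_le hz (im_le_norm_sub z s)
  have hgm := hg.aestronglyMeasurable
  have hmeas : ∀ z : ℂ, AEStronglyMeasurable (fun s : ℝ => (g s : ℂ) / (z - s)) volume := by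
    intro z
    simp_rw [div_eq_mul_inv]
    exact (Complex.continuous_ofReal.comp_aestronglyMeasurable hgm).mul
      (Measurable.aestronglyMeasurable (by fun_prop))
  refine (hasDerivAt_integral_of_dominated_loc_of_deriv_le (𝕜 := ℂ)
    (F := fun z s => (g s : ℂ) / (z - s)) (s := {z : ℂ | δ < z.im})
    (F' := fun z s => -(g s : ℂ) / (z - s) ^ 2) (bound := fun s => |g s| / δ ^ 2)
    ?_ ?_ ?_ ?_ ?_ ?_ ?_).2.differentiableAt.differentiableWithinAt
  · exact (isOpen_lt continuous_const Complex.continuous_im).mem_nhds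
      (show δ < z₀.im by rw [hδ]; linarith)
  · exact Eventually.of_forall hmeas
  · refine (hg.abs.div_const δ).mono' (hmeas z₀) (ae_of_all _ fun s => ?_)
    rw [norm_div, Complex.norm_real, Real.norm_eq_abs]
    gcongr
    exact (him z₀ (show δ < z₀.im by rw [hδ]; linarith) s).le
  · simp_rw [div_eq_mul_inv]
    exact (Complex.continuous_ofReal.comp_aestronglyMeasurable hgm).neg.mul
      (Measurable.aestronglyMeasurable (by fun_prop))
  · refine ae_of_all _ fun s z hz => ?_
    rw [norm_div, norm_neg, Complex.norm_real, Real.norm_eq_abs, norm_pow]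
    gcongr
    exact (him z hz s).le
  · exact hg.abs.div_const _
  · refine ae_of_all _ fun s z hz => ?_
    have hne : z - s ≠ 0 := norm_pos_iff.1 (hδ0.trans (him z hz s))
    have h1 := (hasDerivAt_const z (g s : ℂ)).div ((hasDerivAt_id z).sub_const (s : ℂ)) hne
    refine h1.congr_deriv ?_
    simp

/-- Bounded support makes `‖z - s‖` comparable to `1 + ‖z‖` above height `ε`. The resulting decay
makes `p`-th powers, `p > 1`, admissible in the contour argument. -/
theorem norm_cauchyT_le (hg : BddCpt g) {ε : ℝ} (hε : 0 < ε) :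
    ∃ C, 0 ≤ C ∧ ∀ z : ℂ, ε ≤ z.im → ‖cauchyT g z‖ ≤ C * (1 + ‖z‖)⁻¹ := by
  obtain ⟨N, hN⟩ := hg.cpt
  set L := (1 + |N|) / ε + 1 with hL
  refine ⟨L * ∫ s, |g s|, by positivity, fun z hz => ?_⟩
  have hpt : ∀ s : ℝ, ‖(g s : ℂ) / (z - s)‖ ≤ L * (1 + ‖z‖)⁻¹ * |g s| := by
    intro s
    rcases lt_or_ge N |s| with h | h
    · simp [hN s h]
    · have h1 : ε ≤ ‖z - s‖ := hz.trans (im_le_norm_sub z s)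
      have h2 : ‖z‖ ≤ ‖z - s‖ + |s| := by
        have := norm_add_le (z - s) (s : ℂ)
        rwa [sub_add_cancel, Complex.norm_real, Real.norm_eq_abs] at this
      have h3 : 1 + ‖z‖ ≤ L * ‖z - s‖ := by
        have h4 : 1 + |N| ≤ (1 + |N|) / ε * ‖z - s‖ := by
          rw [div_mul_eq_mul_div, le_div_iff₀ hε]
          gcongr
        have := le_abs_self N
        rw [hL, add_mul, one_mul]
        linarith
      rw [norm_div, Complex.norm_real, Real.norm_eq_abs, div_eq_inv_mul]
      gcongr
      have h5 : 0 < ‖z - s‖ := hε.trans_le h1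
      rw [← div_eq_mul_inv L, inv_eq_one_div, div_le_div_iff₀ h5 (by positivity)]
      linarith
  calc ‖cauchyT g z‖ ≤ ∫ s, L * (1 + ‖z‖)⁻¹ * |g s| :=
        norm_integral_le_of_norm_le (hg.integrable.abs.const_mul _) (ae_of_all _ hpt)
    _ = _ := by rw [integral_const_mul]; ring

theorem enorm_poisI_le {ε : ℝ} (hε : 0 < ε) (hg : Measurable g) (x : ℝ) :
    ‖poisI ε g x‖ₑ ≤ 64 * dyadicMax (fun y => ‖g y‖ₑ) x := by
  refine (enorm_integral_le_lintegral_enorm _).trans ?_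
  refine le_trans (le_of_eq ?_) (lintegral_poisson_le_dyadicMax (g := fun y => ‖g y‖ₑ)
    (by fun_prop) hε x)
  refine lintegral_congr fun s => ?_
  rw [enorm_mul, Real.enorm_of_nonneg (poisK_pos hε _).le]
  rfl

/-! ### M. Riesz' argument: `L^p` bounds for the conjugate function, `1 < p ≤ 2` -/

/-- With `α = arg w` one needs `1 ≤ A * cos α ^ p - B * cos (p * α)` for `|α| < π / 2`. Near `π / 2`
the second cosine is negative and bounded away from zero, since `p * |α|` stays between `π / 2` and
`π`; elsewhere `cos α` is bounded below. The condition `p ≤ 2` keeps `p * |α|` within `π`. -/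
theorem exists_norm_rpow_le {p : ℝ} (hp : 1 < p) (hp2 : p ≤ 2) :
    ∃ A B : ℝ, 0 ≤ A ∧ ∀ w : ℂ, 0 < w.re →
      ‖w‖ ^ p ≤ A * w.re ^ p - B * (w ^ (p : ℂ)).re := by
  have hπ := Real.pi_pos
  -- The threshold angle: `φ * p` is the midpoint of `π / 2` and `p * π / 2`, so `φ < π / 2` while
  -- `cos (φ * p) < 0`.
  set φ := (Real.pi / 2 + p * (Real.pi / 2)) / 2 / p with hφ
  have hpφ : φ * p = (Real.pi / 2 + p * (Real.pi / 2)) / 2 := by rw [hφ]; field_simp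
  have hφ1 : φ < Real.pi / 2 := by
    rw [hφ, div_lt_iff₀ (by linarith)]
    nlinarith
  have hφ0 : 0 < φ := by positivity
  set c := -Real.cos (φ * p) with hc
  have hc0 : 0 < c := by
    have : Real.cos (φ * p) < 0 :=
      Real.cos_neg_of_pi_div_two_lt_of_lt (by rw [hpφ]; nlinarith) (by rw [hpφ]; nlinarith)
    linarith
  set m := Real.cos φ with hm
  have hm0 : 0 < m := Real.cos_pos_of_mem_Ioo ⟨by linarith, hφ1⟩
  have hmp : 0 < m ^ p := Real.rpow_pos_of_pos hm0 p
  refine ⟨(1 + c⁻¹) / m ^ p, c⁻¹, by positivity, fun w hw => ?_⟩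
  rw [Complex.cpow_ofReal_re, ← Complex.norm_mul_cos_arg w]
  have harg : |w.arg| < Real.pi / 2 := Complex.abs_arg_lt_pi_div_two_iff.2 (Or.inl hw)
  have hcosarg : 0 ≤ Real.cos w.arg :=
    Real.cos_nonneg_of_mem_Icc ⟨by linarith [(abs_lt.1 harg).1], (abs_lt.1 harg).2.le⟩
  rw [Real.mul_rpow (norm_nonneg _) hcosarg]
  have key : 1 ≤ (1 + c⁻¹) / m ^ p * Real.cos w.arg ^ p - c⁻¹ * Real.cos (w.arg * p) := by
    rw [← Real.cos_abs w.arg, ← Real.cos_abs (w.arg * p), abs_mul, abs_of_pos (by linarith : 0 < p)]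
    rcases le_total |w.arg| φ with h | h
    · have h1 : m ≤ Real.cos |w.arg| :=
        Real.cos_le_cos_of_nonneg_of_le_pi (abs_nonneg _) (by linarith) h
      have h2 : m ^ p ≤ Real.cos |w.arg| ^ p := by gcongr
      have h3 : 1 + c⁻¹ ≤ (1 + c⁻¹) / m ^ p * Real.cos |w.arg| ^ p := by
        rw [div_mul_eq_mul_div, le_div_iff₀ hmp]
        gcongr
      have h4 : c⁻¹ * Real.cos (|w.arg| * p) ≤ c⁻¹ * 1 := by
        gcongr
        exact Real.cos_le_one _
      linarith
    · have h1 : Real.cos (|w.arg| * p) ≤ Real.cos (φ * p) := by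
        refine Real.cos_le_cos_of_nonneg_of_le_pi (by positivity) ?_ (by gcongr)
        nlinarith
      have h2 : c⁻¹ * Real.cos (|w.arg| * p) ≤ c⁻¹ * (-c) := by
        gcongr
        linarith
      rw [mul_neg, inv_mul_cancel₀ hc0.ne'] at h2
      have h3 : 0 ≤ (1 + c⁻¹) / m ^ p * Real.cos |w.arg| ^ p := by
        have : 0 ≤ Real.cos |w.arg| := by rwa [Real.cos_abs]
        positivity
      linarith
  have hwp : 0 ≤ ‖w‖ ^ p := by positivity
  nlinarith [mul_le_mul_of_nonneg_left key hwp]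

theorem continuous_cauchyT_horizontal (hg : Integrable g) {ε : ℝ} (hε : 0 < ε) :
    Continuous fun x : ℝ => cauchyT g (x + ε * Complex.I) :=
  (differentiableOn_cauchyT hg).continuousOn.comp_continuous (by fun_prop) fun x => by simp [hε]

theorem poisI_pos (hg : Integrable g) (h0 : ∀ x, 0 ≤ g x) (hne : ¬ g =ᵐ[volume] 0)
    {ε : ℝ} (hε : 0 < ε) (x : ℝ) : 0 < poisI ε g x := by
  refine (integral_pos_iff_support_of_nonneg (fun s => mul_nonneg (poisK_pos hε _).le (h0 s))
    (integrable_poisK_mul hg hε x)).2 ?_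
  rw [pos_iff_ne_zero]
  intro h
  refine hne ?_
  have hs : Function.support (fun s => poisK ε (x - s) * g s) = Function.support g := by
    ext s
    simp [(poisK_pos hε _).ne']
  rw [hs] at h
  exact ae_iff.2 h

/-- M. Riesz' argument. The function `W = I * cauchyT g` has real part the Poisson integral, so `W ^
p` is holomorphic in the upper half-plane and its integral over a horizontal line vanishes.
Integrating the pointwise inequality therefore removes the `B` term. -/
theorem lintegral_cauchyT_rpow_le_poisI {p : ℝ} (hp : 1 < p) {A B : ℝ} (hA : 0 ≤ A)
    (hAB : ∀ w : ℂ, 0 < w.re → ‖w‖ ^ p ≤ A * w.re ^ p - B * (w ^ (p : ℂ)).re)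
    (hg : BddCpt g) (h0 : ∀ x, 0 ≤ g x) {ε : ℝ} (hε : 0 < ε) :
    ∫⁻ x : ℝ, ‖cauchyT g (x + ε * Complex.I)‖ₑ ^ p ≤
      ENNReal.ofReal A * ∫⁻ x : ℝ, ‖poisI ε g x‖ₑ ^ p := by
  have hp0 : 0 < p := by linarith
  by_cases hne : g =ᵐ[volume] 0
  · have : ∀ z, cauchyT g z = 0 := fun z => by
      refine integral_eq_zero_of_ae ?_
      filter_upwards [hne] with s hs
      simp [hs]
    simp [this, hp0]
  have hgi := hg.integrable
  -- The factor `I` moves the values into the right half-plane, away from the branch cut of the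
  -- power.
  set W : ℂ → ℂ := fun z => Complex.I * cauchyT g z with hW
  have hWre : ∀ x ε : ℝ, 0 < ε → (W (x + ε * Complex.I)).re = poisI ε g x := by
    intro x ε hε
    rw [poisI_eq_im hgi hε, hW]
    simp
  have hWpos : ∀ z : ℂ, 0 < z.im → 0 < (W z).re := by
    intro z hz
    have := hWre z.re z.im hz
    rw [Complex.re_add_im] at this
    rw [this]
    exact poisI_pos hgi h0 hne hz _
  have hWnorm : ∀ z, ‖W z‖ = ‖cauchyT g z‖ := fun z => by simp [hW]
  obtain ⟨C, hC, hdec⟩ := norm_cauchyT_le hg hε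
  have hGdec : ∀ z : ℂ, ε ≤ z.im → ‖W z ^ (p : ℂ)‖ ≤ C ^ p * (1 + ‖z‖) ^ (-p) := by
    intro z hz
    rw [Complex.norm_cpow_real, hWnorm, Real.rpow_neg (by positivity),
      ← Real.inv_rpow (by positivity), ← Real.mul_rpow hC (by positivity)]
    exact Real.rpow_le_rpow (norm_nonneg _) (hdec z hz) hp0.le
  have hGdiff : DifferentiableOn ℂ (fun z => W z ^ (p : ℂ)) {z | 0 < z.im} :=
    ((differentiableOn_cauchyT hgi).const_mul _).cpow_const
      fun z hz => Or.inl (hWpos z hz)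
  have hzero := integral_horizontal_eq_zero hε hp
    (hGdiff.mono fun z (hz : ε ≤ z.im) => lt_of_lt_of_le hε hz) hGdec
  have hGcont : Continuous fun x : ℝ => W (x + ε * Complex.I) ^ (p : ℂ) :=
    hGdiff.continuousOn.comp_continuous (by fun_prop) fun x => by simp [hε]
  have hGdec' : ∀ x : ℝ, ‖W (x + ε * Complex.I) ^ (p : ℂ)‖ ≤ C ^ p * (1 + |x|) ^ (-p) := by
    intro x
    refine (hGdec _ (by simp)).trans ?_
    gcongr C ^ p * ?_
    refine Real.rpow_le_rpow_of_nonpos (by positivity) ?_ (by linarith)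
    gcongr
    simpa using Complex.abs_re_le_norm (x + ε * Complex.I)
  have hGint : Integrable fun x : ℝ => W (x + ε * Complex.I) ^ (p : ℂ) :=
    integrable_of_norm_le_one_add hp hGcont.aestronglyMeasurable hGdec'
  have hnorm : Integrable fun x : ℝ => ‖cauchyT g (x + ε * Complex.I)‖ ^ p :=
    hGint.norm.congr (ae_of_all _ fun x => by
      simp only [Complex.norm_cpow_real, hWnorm])
  have hpcont : Continuous (poisI ε g) := by
    have : poisI ε g = fun x : ℝ => -(cauchyT g (x + ε * Complex.I)).im :=
      funext fun x => poisI_eq_im hgi hε x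
    rw [this]
    exact (Complex.continuous_im.comp (continuous_cauchyT_horizontal hgi hε)).neg
  have hpos : ∀ x, 0 < poisI ε g x := fun x => poisI_pos hgi h0 hne hε x
  have hpois : Integrable fun x : ℝ => poisI ε g x ^ p := by
    refine hnorm.mono' (hpcont.measurable.pow_const p).aestronglyMeasurable
      (ae_of_all _ fun x => ?_)
    rw [Real.norm_of_nonneg (Real.rpow_nonneg (hpos x).le _)]
    refine Real.rpow_le_rpow (hpos x).le ?_ hp0.le
    rw [poisI_eq_im hgi hε]
    exact (neg_le_abs _).trans (Complex.abs_im_le_norm _)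
  have hreal : ∫ x : ℝ, ‖cauchyT g (x + ε * Complex.I)‖ ^ p ≤ A * ∫ x, poisI ε g x ^ p := by
    calc ∫ x : ℝ, ‖cauchyT g (x + ε * Complex.I)‖ ^ p
        ≤ ∫ x : ℝ, (A * poisI ε g x ^ p - B * (W (x + ε * Complex.I) ^ (p : ℂ)).re) := by
          refine integral_mono hnorm ((hpois.const_mul A).sub (hGint.re.const_mul B)) fun x => ?_
          have := hAB (W (x + ε * Complex.I)) (by rw [hWre x ε hε]; exact hpos x)
          rwa [hWre x ε hε, hWnorm] at this
      _ = A * ∫ x, poisI ε g x ^ p := by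
          have hre : ∫ x : ℝ, (W (x + ε * Complex.I) ^ (p : ℂ)).re = 0 := by
            have := integral_re hGint
            simp only [RCLike.re_to_complex] at this
            rw [this, hzero, Complex.zero_re]
          have hreint : Integrable fun x : ℝ => (W (x + ε * Complex.I) ^ (p : ℂ)).re := hGint.re
          rw [integral_sub (hpois.const_mul A) (hreint.const_mul B), integral_const_mul,
            integral_const_mul, hre, mul_zero, sub_zero]
  have e1 : ∫⁻ x : ℝ, ‖cauchyT g (x + ε * Complex.I)‖ₑ ^ p =
      ENNReal.ofReal (∫ x : ℝ, ‖cauchyT g (x + ε * Complex.I)‖ ^ p) := by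
    rw [ofReal_integral_eq_lintegral_ofReal hnorm (ae_of_all _ fun x => by positivity)]
    refine lintegral_congr fun x => ?_
    rw [← ofReal_norm, ENNReal.ofReal_rpow_of_nonneg (norm_nonneg _) hp0.le]
  have e2 : ∫⁻ x : ℝ, ‖poisI ε g x‖ₑ ^ p = ENNReal.ofReal (∫ x : ℝ, poisI ε g x ^ p) := by
    rw [ofReal_integral_eq_lintegral_ofReal hpois
      (ae_of_all _ fun x => Real.rpow_nonneg (hpos x).le _)]
    refine lintegral_congr fun x => ?_
    rw [Real.enorm_of_nonneg (hpos x).le, ENNReal.ofReal_rpow_of_nonneg (hpos x).le hp0.le]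
  rw [e1, e2, ← ENNReal.ofReal_mul hA]
  exact ENNReal.ofReal_le_ofReal hreal

theorem lintegral_poisI_rpow_le {p : ℝ} (hp : 1 < p) :
    ∃ K : NNReal, ∀ g : ℝ → ℝ, Measurable g → ∀ ε : ℝ, 0 < ε →
      ∫⁻ x, ‖poisI ε g x‖ₑ ^ p ≤ K * ∫⁻ x, ‖g x‖ₑ ^ p := by
  have hp0 : 0 < p := by linarith
  refine ⟨64 ^ p * (20 * p * 4 ^ (p - 1) / (p - 1)).toNNReal, fun g hg ε hε => ?_⟩
  calc ∫⁻ x, ‖poisI ε g x‖ₑ ^ p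
      ≤ ∫⁻ x, 64 ^ p * dyadicMax (fun y => ‖g y‖ₑ) x ^ p := by
        refine lintegral_mono fun x => ?_
        rw [← ENNReal.mul_rpow_of_nonneg _ _ hp0.le]
        exact ENNReal.rpow_le_rpow (enorm_poisI_le hε hg x) hp0.le
    _ ≤ 64 ^ p * (ENNReal.ofReal (20 * p * 4 ^ (p - 1) / (p - 1)) * ∫⁻ x, ‖g x‖ₑ ^ p) := by
        rw [lintegral_const_mul _ ((measurable_dyadicMax (by fun_prop)).pow_const p)]
        gcongr
        exact lintegral_dyadicMax_rpow_le hp (by fun_prop)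
    _ = _ := by
        rw [ENNReal.coe_mul, ENNReal.coe_rpow_of_nonneg _ hp0.le, ENNReal.coe_ofNat, mul_assoc ((64 : ℝ≥0∞) ^ p)]
        rfl

theorem lintegral_cauchyT_rpow_le_of_le_two {p : ℝ} (hp : 1 < p) (hp2 : p ≤ 2) :
    ∃ K : NNReal, ∀ g : ℝ → ℝ, BddCpt g → (∀ x, 0 ≤ g x) → ∀ ε : ℝ, 0 < ε →
      ∫⁻ x : ℝ, ‖cauchyT g (x + ε * Complex.I)‖ₑ ^ p ≤ K * ∫⁻ x, ‖g x‖ₑ ^ p := by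
  obtain ⟨A, B, hA, hAB⟩ := exists_norm_rpow_le hp hp2
  obtain ⟨K, hK⟩ := lintegral_poisI_rpow_le hp
  refine ⟨A.toNNReal * K, fun g hg h0 ε hε => ?_⟩
  refine (lintegral_cauchyT_rpow_le_poisI hp hA hAB hg h0 hε).trans ?_
  rw [ENNReal.coe_mul, mul_assoc]
  gcongr
  · exact le_rfl
  · exact hK g hg.meas ε hε

end

section

variable {g f k : ℝ → ℝ}

/-! ### `L^p` bounds for the conjugate function, all `1 < p < ∞`, by duality -/

theorem BddCpt.of_abs_le (hg : BddCpt g) (hf : Measurable f) (h : ∀ x, |f x| ≤ |g x|) :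
    BddCpt f := by
  obtain ⟨B, hB⟩ := hg.bdd
  obtain ⟨N, hN⟩ := hg.cpt
  refine ⟨hf, ⟨B, fun x => (h x).trans (hB x)⟩, N, fun x hx => ?_⟩
  have := h x
  rw [hN x hx, abs_zero] at this
  exact abs_nonpos_iff.1 this

theorem BddCpt.posPart (hg : BddCpt g) : BddCpt fun x => max (g x) 0 :=
  hg.of_abs_le (hg.meas.max measurable_const) fun x => by
    rw [abs_of_nonneg (le_max_right _ _)]
    exact max_le (le_abs_self _) (abs_nonneg _)

theorem BddCpt.neg (hg : BddCpt g) : BddCpt fun x => -g x :=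
  hg.of_abs_le hg.meas.neg fun x => by rw [abs_neg]

theorem conjI_eq_re (hg : Integrable g) {ε : ℝ} (hε : 0 < ε) (x : ℝ) :
    conjI ε g x = (cauchyT g (x + ε * Complex.I)).re := by
  simp [cauchyT_eq hg hε]

theorem enorm_conjI_le (hg : Integrable g) {ε : ℝ} (hε : 0 < ε) (x : ℝ) :
    ‖conjI ε g x‖ₑ ≤ ‖cauchyT g (x + ε * Complex.I)‖ₑ := by
  rw [conjI_eq_re hg hε, enorm_le_iff_norm_le, Real.norm_eq_abs]
  exact Complex.abs_re_le_norm _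

theorem continuous_conjI (hg : Integrable g) {ε : ℝ} (hε : 0 < ε) : Continuous (conjI ε g) := by
  have : conjI ε g = fun x : ℝ => (cauchyT g (x + ε * Complex.I)).re :=
    funext fun x => conjI_eq_re hg hε x
  rw [this]
  exact Complex.continuous_re.comp (continuous_cauchyT_horizontal hg hε)

/-- The contour argument needs nonnegative data, so positive and negative parts are treated
separately. -/
theorem lintegral_conjI_rpow_le_of_le_two {p : ℝ} (hp : 1 < p) (hp2 : p ≤ 2) :
    ∃ K : NNReal, ∀ g : ℝ → ℝ, BddCpt g → ∀ ε : ℝ, 0 < ε →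
      ∫⁻ x : ℝ, ‖conjI ε g x‖ₑ ^ p ≤ K * ∫⁻ x, ‖g x‖ₑ ^ p := by
  have hp0 : 0 < p := by linarith
  obtain ⟨K, hK⟩ := lintegral_cauchyT_rpow_le_of_le_two hp hp2
  have hpos : ∀ g : ℝ → ℝ, BddCpt g → ∀ ε : ℝ, 0 < ε →
      ∫⁻ x : ℝ, ‖conjI ε (fun x => max (g x) 0) x‖ₑ ^ p ≤ K * ∫⁻ x, ‖g x‖ₑ ^ p := by
    intro g hg ε hε
    calc ∫⁻ x : ℝ, ‖conjI ε (fun x => max (g x) 0) x‖ₑ ^ p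
        ≤ ∫⁻ x : ℝ, ‖cauchyT (fun x => max (g x) 0) (x + ε * Complex.I)‖ₑ ^ p := by
          gcongr with x
          exact enorm_conjI_le hg.posPart.integrable hε x
      _ ≤ K * ∫⁻ x, ‖max (g x) 0‖ₑ ^ p :=
          hK _ hg.posPart (fun x => le_max_right _ _) ε hε
      _ ≤ K * ∫⁻ x, ‖g x‖ₑ ^ p := by
          gcongr with x
          rw [enorm_le_iff_norm_le, Real.norm_eq_abs, Real.norm_eq_abs,
            abs_of_nonneg (le_max_right _ _)]
          exact max_le (le_abs_self _) (abs_nonneg _)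
  refine ⟨2 ^ (p - 1) * (2 * K), fun g hg ε hε => ?_⟩
  have hsplit : ∀ x, conjI ε g x =
      conjI ε (fun x => max (g x) 0) x - conjI ε (fun x => max (-g x) 0) x := by
    intro x
    unfold conjI
    rw [← integral_sub (integrable_conjK_mul hg.posPart.integrable hε x)
      (integrable_conjK_mul hg.neg.posPart.integrable hε x)]
    refine integral_congr_ae (ae_of_all _ fun s => ?_)
    simp only
    rw [← mul_sub, max_zero_sub_max_neg_zero_eq_self]
  calc ∫⁻ x : ℝ, ‖conjI ε g x‖ₑ ^ p
      ≤ ∫⁻ x : ℝ, 2 ^ (p - 1) * (‖conjI ε (fun x => max (g x) 0) x‖ₑ ^ p +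
          ‖conjI ε (fun x => max (-g x) 0) x‖ₑ ^ p) := by
        refine lintegral_mono fun x => ?_
        rw [hsplit]
        exact (ENNReal.rpow_le_rpow enorm_sub_le hp0.le).trans
          (ENNReal.rpow_add_le_mul_rpow_add_rpow _ _ hp.le)
    _ = 2 ^ (p - 1) * ((∫⁻ x : ℝ, ‖conjI ε (fun x => max (g x) 0) x‖ₑ ^ p) +
          ∫⁻ x : ℝ, ‖conjI ε (fun x => max (-g x) 0) x‖ₑ ^ p) := by
        have h1 := (continuous_conjI hg.posPart.integrable hε).measurable
        have h2 := (continuous_conjI hg.neg.posPart.integrable hε).measurable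
        rw [lintegral_const_mul _ (by fun_prop), lintegral_add_left (by fun_prop)]
    _ ≤ 2 ^ (p - 1) * (K * (∫⁻ x, ‖g x‖ₑ ^ p) + K * ∫⁻ x, ‖-g x‖ₑ ^ p) := by
        gcongr
        · exact hpos g hg ε hε
        · exact hpos _ hg.neg ε hε
    _ = _ := by
        simp_rw [enorm_neg]
        rw [ENNReal.coe_mul, ENNReal.coe_rpow_of_nonneg _ (by linarith), ENNReal.coe_mul,
          ENNReal.coe_ofNat]
        ring

/-- Fubini and oddness of the kernel: the operator is minus its own transpose. -/
theorem integral_conjI_mul (hf : Integrable f) (hk : Integrable k) {ε : ℝ} (hε : 0 < ε) :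
    ∫ x, conjI ε f x * k x = -∫ s, f s * conjI ε k s := by
  have hint : Integrable (fun q : ℝ × ℝ => conjK ε (q.1 - q.2) * (k q.1 * f q.2))
      (volume.prod volume) :=
    (hk.mul_prod hf).bdd_mul (c := 1 / ε) (Measurable.aestronglyMeasurable (by fun_prop))
      (ae_of_all _ fun q => abs_conjK_le hε _)
  calc ∫ x, conjI ε f x * k x
      = ∫ x, ∫ s, conjK ε (x - s) * (k x * f s) := by
        refine integral_congr_ae (ae_of_all _ fun x => ?_)
        simp only [conjI]
        rw [← integral_mul_const]
        refine integral_congr_ae (ae_of_all _ fun s => ?_)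
        simp only
        ring
    _ = ∫ s, ∫ x, conjK ε (x - s) * (k x * f s) := integral_integral_swap hint
    _ = ∫ s, -(f s * conjI ε k s) := by
        refine integral_congr_ae (ae_of_all _ fun s => ?_)
        simp only [conjI]
        rw [← integral_const_mul, ← integral_neg]
        refine integral_congr_ae (ae_of_all _ fun x => ?_)
        simp only
        rw [← neg_sub, conjK_neg]
        ring
    _ = _ := integral_neg _

/-- The absorption step of the duality argument: `X ^ (1 / q)` is cancelled, which is legitimate
only for finite `X`. -/
theorem le_of_le_mul_rpow {X Y K : ℝ≥0∞} {p q : ℝ} (hpq : p.HolderConjugate q) (hX : X ≠ ⊤)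
    (h : X ≤ Y ^ (1 / p) * (K * X) ^ (1 / q)) : X ≤ K ^ (p - 1) * Y := by
  have hp := hpq.pos
  have hq := hpq.symm.pos
  rcases eq_or_ne X 0 with rfl | h0
  · exact zero_le
  have hXq : X ^ (1 / q) ≠ 0 := by simp [h0, hX]
  have hXq' : X ^ (1 / q) ≠ ⊤ := ENNReal.rpow_ne_top_of_nonneg (by positivity) hX
  have hsum : 1 / p + 1 / q = 1 := by simpa using hpq.inv_add_inv_eq_one
  have h1 : X ^ (1 / p) ≤ Y ^ (1 / p) * K ^ (1 / q) := by
    rw [ENNReal.mul_rpow_of_nonneg _ _ (by positivity), ← mul_assoc] at h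
    have h2 : X = X ^ (1 / p) * X ^ (1 / q) := by
      rw [← ENNReal.rpow_add _ _ h0 hX, hsum, ENNReal.rpow_one]
    have h3 : X ^ (1 / p) * X ^ (1 / q) ≤ (Y ^ (1 / p) * K ^ (1 / q)) * X ^ (1 / q) :=
      h2 ▸ h
    exact (ENNReal.mul_le_mul_iff_left hXq hXq').1 h3
  have h2 := ENNReal.rpow_le_rpow h1 hp.le
  rw [ENNReal.mul_rpow_of_nonneg _ _ hp.le, ← ENNReal.rpow_mul, ← ENNReal.rpow_mul,
    ← ENNReal.rpow_mul, one_div_mul_cancel hp.ne', ENNReal.rpow_one, ENNReal.rpow_one] at h2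
  have h3 : 1 / q * p = p - 1 := by
    have : 1 / q = 1 - 1 / p := by linarith
    rw [this]; field_simp
  rwa [h3, mul_comm] at h2

/-- Duality with the exponent `q ≤ 2`. Working on `[-n, n]` keeps the test function bounded with
bounded support and the integral finite; then `n → ∞`. -/
theorem lintegral_conjI_rpow_le_of_two_le {p : ℝ} (hp2 : 2 ≤ p) :
    ∃ K : NNReal, ∀ g : ℝ → ℝ, BddCpt g → ∀ ε : ℝ, 0 < ε →
      ∫⁻ x : ℝ, ‖conjI ε g x‖ₑ ^ p ≤ K * ∫⁻ x, ‖g x‖ₑ ^ p := by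
  have hp : 1 < p := by linarith
  have hp0 : 0 < p := by linarith
  set q := p / (p - 1) with hq
  have hpq : p.HolderConjugate q := Real.HolderConjugate.conjExponent hp
  have hq1 : 1 < q := hpq.symm.lt
  have hq2 : q ≤ 2 := by rw [hq, div_le_iff₀ (by linarith)]; linarith
  obtain ⟨K, hK⟩ := lintegral_conjI_rpow_le_of_le_two hq1 hq2
  refine ⟨K ^ (p - 1), fun f hf ε hε => ?_⟩
  rw [ENNReal.coe_rpow_of_nonneg _ (by linarith)]
  have hcont := continuous_conjI hf.integrable hε
  set h := conjI ε f with hh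
  have hcov : AECover volume atTop fun n : ℕ => Icc (-(n : ℝ)) n :=
    aecover_Icc (tendsto_neg_atTop_atBot.comp tendsto_natCast_atTop_atTop)
      tendsto_natCast_atTop_atTop
  refine le_of_tendsto' (hcov.lintegral_tendsto_of_countably_generated
    (by fun_prop)) fun n => ?_
  -- The extremal function for Hölder's inequality: on the interval both `h * k` and `|k| ^ q` equal
  -- `|h| ^ p`.
  set k : ℝ → ℝ := (Icc (-(n : ℝ)) n).indicator fun x => h x * |h x| ^ (p - 2) with hk
  obtain ⟨M, hM⟩ := isCompact_Icc.exists_bound_of_continuousOn (s := Icc (-(n : ℝ)) n)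
    hcont.continuousOn
  have hkb : BddCpt k := by
    refine ⟨Measurable.indicator (by fun_prop) measurableSet_Icc,
      ⟨M * M ^ (p - 2), fun x => ?_⟩, n, fun x hx => ?_⟩
    · by_cases hx : x ∈ Icc (-(n : ℝ)) n
      · rw [hk, indicator_of_mem hx, abs_mul, abs_of_nonneg (Real.rpow_nonneg (abs_nonneg _) _)]
        have := hM x hx
        rw [Real.norm_eq_abs] at this
        have hM0 : 0 ≤ M := (abs_nonneg _).trans this
        gcongr
      · have hM0 : 0 ≤ M := (norm_nonneg _).trans (hM 0 (by simp))
        rw [hk, indicator_of_notMem hx, abs_zero]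
        positivity
    · rw [hk, indicator_of_notMem]
      exact fun h' => absurd (abs_le.2 h') (not_le.2 hx)
  have hhk : ∀ x, h x * k x = (Icc (-(n : ℝ)) n).indicator (fun x => |h x| ^ p) x := by
    intro x
    by_cases hx : x ∈ Icc (-(n : ℝ)) n
    · rw [hk, indicator_of_mem hx, indicator_of_mem hx, ← mul_assoc, ← abs_mul_abs_self]
      rcases eq_or_ne (h x) 0 with h0 | h0
      · simp [h0, hp0.ne']
      · have : 0 < |h x| := abs_pos.2 h0
        rw [Real.rpow_sub this, Real.rpow_two]
        field_simp
    · rw [hk, indicator_of_notMem hx, indicator_of_notMem hx, mul_zero]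
  have hkq : ∀ x, ‖k x‖ₑ ^ q = (Icc (-(n : ℝ)) n).indicator (fun x => ‖h x‖ₑ ^ p) x := by
    intro x
    by_cases hx : x ∈ Icc (-(n : ℝ)) n
    · rw [hk, indicator_of_mem hx, indicator_of_mem hx]
      rw [← ofReal_norm, ← ofReal_norm, ENNReal.ofReal_rpow_of_nonneg (norm_nonneg _) hpq.symm.nonneg,
        ENNReal.ofReal_rpow_of_nonneg (norm_nonneg _) hp0.le, Real.norm_eq_abs, Real.norm_eq_abs,
        abs_mul, abs_of_nonneg (Real.rpow_nonneg (abs_nonneg _) _)]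
      congr 1
      rcases eq_or_ne (h x) 0 with h0 | h0
      · simp [h0, hp0.ne', hpq.symm.ne_zero]
      · have h1 : 0 < |h x| := abs_pos.2 h0
        have h2 : |h x| * |h x| ^ (p - 2) = |h x| ^ (p - 1) := by
          rw [show p - 1 = 1 + (p - 2) by ring, Real.rpow_add h1, Real.rpow_one]
        rw [h2, ← Real.rpow_mul h1.le, hq]
        congr 1
        have : p - 1 ≠ 0 := by linarith
        field_simp
    · rw [hk, indicator_of_notMem hx, indicator_of_notMem hx]
      simp [hpq.symm.pos]
  set X := ∫⁻ x in Icc (-(n : ℝ)) n, ‖h x‖ₑ ^ p with hX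
  have hXk : ∫⁻ x, ‖k x‖ₑ ^ q = X := by
    simp_rw [hkq]
    rw [lintegral_indicator measurableSet_Icc]
  have hcontp : Continuous fun x => |h x| ^ p :=
    hcont.abs.rpow_const fun x => Or.inr hp0.le
  have hXint : X = ENNReal.ofReal (∫ x, h x * k x) := by
    simp_rw [hhk]
    rw [integral_indicator measurableSet_Icc, ofReal_integral_eq_lintegral_ofReal
      (hcontp.integrableOn_Icc) (ae_of_all _ fun x => by positivity)]
    refine lintegral_congr fun x => ?_
    rw [← ofReal_norm, ENNReal.ofReal_rpow_of_nonneg (norm_nonneg _) hp0.le, Real.norm_eq_abs]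
  have hXtop : X ≠ ⊤ := by rw [hXint]; exact ENNReal.ofReal_ne_top
  refine le_of_le_mul_rpow hpq hXtop ?_
  calc X ≤ ‖∫ x, h x * k x‖ₑ := by rw [hXint]; exact Real.ofReal_le_enorm _
    _ = ‖∫ s, f s * conjI ε k s‖ₑ := by
        rw [integral_conjI_mul hf.integrable hkb.integrable hε, enorm_neg]
    _ ≤ ∫⁻ s, ‖f s‖ₑ * ‖conjI ε k s‖ₑ := by
        refine (enorm_integral_le_lintegral_enorm _).trans (le_of_eq ?_)
        simp_rw [enorm_mul]
    _ ≤ (∫⁻ s, ‖f s‖ₑ ^ p) ^ (1 / p) * (∫⁻ s, ‖conjI ε k s‖ₑ ^ q) ^ (1 / q) := by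
        have h1 := hf.meas
        have h2 := (continuous_conjI hkb.integrable hε).measurable
        exact ENNReal.lintegral_mul_le_Lp_mul_Lq _ hpq (by fun_prop) (by fun_prop)
    _ ≤ _ := by
        have := hpq.symm.pos
        gcongr
        rw [← hXk]
        exact hK k hkb ε hε

theorem lintegral_conjI_rpow_le {p : ℝ} (hp : 1 < p) :
    ∃ K : NNReal, ∀ g : ℝ → ℝ, BddCpt g → ∀ ε : ℝ, 0 < ε →
      ∫⁻ x : ℝ, ‖conjI ε g x‖ₑ ^ p ≤ K * ∫⁻ x, ‖g x‖ₑ ^ p := by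
  rcases le_total p 2 with h | h
  · exact lintegral_conjI_rpow_le_of_le_two hp h
  · exact lintegral_conjI_rpow_le_of_two_le h

theorem lintegral_cauchyT_rpow_le {p : ℝ} (hp : 1 < p) :
    ∃ K : NNReal, ∀ g : ℝ → ℝ, BddCpt g → ∀ ε : ℝ, 0 < ε →
      ∫⁻ x : ℝ, ‖cauchyT g (x + ε * Complex.I)‖ₑ ^ p ≤ K * ∫⁻ x, ‖g x‖ₑ ^ p := by
  have hp0 : 0 < p := by linarith
  obtain ⟨K₁, h₁⟩ := lintegral_conjI_rpow_le hp
  obtain ⟨K₂, h₂⟩ := lintegral_poisI_rpow_le hp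
  refine ⟨2 ^ (p - 1) * (K₁ + K₂), fun g hg ε hε => ?_⟩
  have hm := (continuous_conjI hg.integrable hε).measurable
  calc ∫⁻ x : ℝ, ‖cauchyT g (x + ε * Complex.I)‖ₑ ^ p
      ≤ ∫⁻ x : ℝ, 2 ^ (p - 1) * (‖conjI ε g x‖ₑ ^ p + ‖poisI ε g x‖ₑ ^ p) := by
        refine lintegral_mono fun x => ?_
        refine le_trans ?_ (ENNReal.rpow_add_le_mul_rpow_add_rpow _ _ hp.le)
        refine ENNReal.rpow_le_rpow ?_ hp0.le
        rw [cauchyT_eq hg.integrable hε]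
        refine enorm_sub_le.trans (add_le_add (le_of_eq ?_) (le_of_eq ?_))
        · rw [← ofReal_norm, Complex.norm_real, ofReal_norm]
        · rw [← ofReal_norm, norm_mul, Complex.norm_real, Complex.norm_I, mul_one, ofReal_norm]
    _ = 2 ^ (p - 1) * ((∫⁻ x : ℝ, ‖conjI ε g x‖ₑ ^ p) + ∫⁻ x : ℝ, ‖poisI ε g x‖ₑ ^ p) := by
        rw [lintegral_const_mul' _ _ (ENNReal.rpow_ne_top_of_nonneg (by linarith) (by simp)),
          lintegral_add_left (by fun_prop)]
    _ ≤ 2 ^ (p - 1) * (K₁ * (∫⁻ x, ‖g x‖ₑ ^ p) + K₂ * ∫⁻ x, ‖g x‖ₑ ^ p) := by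
        gcongr
        · exact h₁ g hg ε hε
        · exact h₂ g hg.meas ε hε
    _ = _ := by
        rw [ENNReal.coe_mul, ENNReal.coe_rpow_of_nonneg _ (by linarith), ENNReal.coe_add,
          ENNReal.coe_ofNat]
        ring

end

section

variable {g f k : ℝ → ℝ}

/-! ### Poisson representation of the Cauchy transform and its maximal function -/

theorem integral_poisK {t : ℝ} (ht : 0 < t) (x : ℝ) : ∫ y, poisK t (x - y) = Real.pi := by
  have h1 : ∫ y, poisK t (x - y) = ∫ y, poisK t y := integral_sub_left_eq_self (poisK t) volume x
  have h2 : ∫ y, poisK t y = ∫ y, t⁻¹ * (1 + (t⁻¹ * y) ^ 2)⁻¹ := by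
    refine integral_congr_ae (ae_of_all _ fun y => ?_)
    simp only [poisK]
    field_simp
    ring
  rw [h1, h2, integral_const_mul, Measure.integral_comp_mul_left (fun y => (1 + y ^ 2)⁻¹) t⁻¹,
    integral_univ_inv_one_add_sq, inv_inv, abs_of_pos ht, smul_eq_mul, ← mul_assoc,
    inv_mul_cancel₀ ht.ne', one_mul]

theorem integrable_poisK {t : ℝ} (ht : 0 < t) (x : ℝ) : Integrable fun y => poisK t (x - y) := by
  by_contra h
  have := integral_poisK ht x
  rw [integral_undef h] at this
  exact Real.pi_pos.ne this

/-- Only large `z` need an explicit estimate; the rest of the half-plane is covered by compactness.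
This avoids estimating a difference quotient near its base point. -/
theorem exists_decay_of_eventually {G : ℂ → ℂ} {ε R C : ℝ}
    (hG : ContinuousOn G {z | ε ≤ z.im})
    (hdec : ∀ z : ℂ, ε ≤ z.im → R ≤ ‖z‖ → ‖G z‖ ≤ C * (1 + ‖z‖) ^ (-2 : ℝ)) :
    ∃ C', ∀ z : ℂ, ε ≤ z.im → ‖G z‖ ≤ C' * (1 + ‖z‖) ^ (-2 : ℝ) := by
  have hcpt : IsCompact (closedBall (0 : ℂ) R ∩ {z | ε ≤ z.im}) :=
    (isCompact_closedBall 0 R).inter_right (isClosed_le continuous_const Complex.continuous_im)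
  obtain ⟨M, hM⟩ := hcpt.exists_bound_of_continuousOn (hG.mono inter_subset_right)
  refine ⟨max C (|M| * (1 + R) ^ (2 : ℝ)), fun z hz => ?_⟩
  have h0 : 0 ≤ (1 + ‖z‖) ^ (-2 : ℝ) := by positivity
  rcases le_total R ‖z‖ with h | h
  · exact (hdec z hz h).trans (mul_le_mul_of_nonneg_right (le_max_left _ _) h0)
  · refine le_trans ?_ (mul_le_mul_of_nonneg_right (le_max_right _ _) h0)
    have h1 : ‖G z‖ ≤ |M| := (hM z ⟨by simpa using h, hz⟩).trans (le_abs_self M)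
    have h2 : 1 ≤ (1 + R) ^ (2 : ℝ) * (1 + ‖z‖) ^ (-2 : ℝ) := by
      rw [Real.rpow_neg (by positivity), ← div_eq_mul_inv, one_le_div (by positivity)]
      gcongr
    calc ‖G z‖ ≤ |M| * 1 := by linarith
      _ ≤ |M| * ((1 + R) ^ (2 : ℝ) * (1 + ‖z‖) ^ (-2 : ℝ)) := by gcongr
      _ = _ := by ring

theorem half_norm_le_norm_sub {z w : ℂ} (h : 2 * ‖z‖ ≤ ‖w‖) : ‖w‖ / 2 ≤ ‖w - z‖ := by
  have := norm_sub_norm_le w z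
  linarith

/-- The values of the Cauchy transform on a line are Poisson integrals of those on a lower line. -/
theorem pi_mul_cauchyT_eq (hg : BddCpt g) {ε t : ℝ} (hε : 0 < ε) (ht : 0 < t) (x : ℝ) :
    (Real.pi : ℂ) * cauchyT g (x + (ε + t : ℝ) * Complex.I) =
      ∫ y : ℝ, (poisK t (x - y) : ℂ) * cauchyT g (y + ε * Complex.I) := by
  set F := cauchyT g with hF
  set z : ℂ := x + (ε + t : ℝ) * Complex.I with hz
  -- The reflection of `z` in the line of height `ε`; it lies below that line and creates no pole
  -- above it.
  set z' : ℂ := x + (ε - t : ℝ) * Complex.I with hz'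
  have hzim : z.im = ε + t := by simp [hz]
  have hz'im : z'.im = ε - t := by simp [hz']
  have hdiff : DifferentiableOn ℂ F {w | 0 < w.im} := differentiableOn_cauchyT hg.integrable
  have hopen : IsOpen {w : ℂ | 0 < w.im} := isOpen_lt continuous_const Complex.continuous_im
  have hnhds : {w : ℂ | 0 < w.im} ∈ 𝓝 z := hopen.mem_nhds (by simp only [mem_ofPred_eq]; linarith)
  have hslope : DifferentiableOn ℂ (dslope F z) {w | 0 < w.im} :=
    (Complex.differentiableOn_dslope hnhds).2 hdiff
  -- On the line, `2 * t * I / ((w - z) * (w - z'))` is `2 * I` times the Poisson kernel.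
  -- Subtracting `F z` removes the pole at `z`, so no residue is needed: the vanishing integral and
  -- total mass `π` give the formula.
  set G : ℂ → ℂ := fun w => dslope F z w * (2 * t * Complex.I / (w - z')) with hG
  have hz'ne : ∀ w : ℂ, ε ≤ w.im → w - z' ≠ 0 := by
    intro w hw h
    have := congrArg Complex.im h
    rw [Complex.sub_im, hz'im, Complex.zero_im] at this
    linarith
  have hGdiff : DifferentiableOn ℂ G {w | ε ≤ w.im} := by
    refine (hslope.mono fun w (hw : ε ≤ w.im) => lt_of_lt_of_le hε hw).mul ?_
    exact (differentiableOn_const _).div (by fun_prop) fun w hw => hz'ne w hw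
  have hGeq : ∀ w, w ≠ z → G w = (F w - F z) * (2 * t * Complex.I / ((w - z) * (w - z'))) := by
    intro w hw
    simp only [hG]
    rw [dslope_of_ne _ hw, slope_def_field, div_mul_div_comm, mul_div_assoc]
  obtain ⟨C, hC, hdec⟩ := norm_cauchyT_le hg hε
  have hFC : ∀ w : ℂ, ε ≤ w.im → ‖F w‖ ≤ C := fun w hw => by
    refine (hdec w hw).trans (mul_le_of_le_one_right hC (inv_le_one_of_one_le₀ ?_))
    linarith [norm_nonneg w]
  have hGdec : ∀ w : ℂ, ε ≤ w.im → 2 * ‖z‖ + 2 * ‖z'‖ + 1 ≤ ‖w‖ →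
      ‖G w‖ ≤ (64 * C * t) * (1 + ‖w‖) ^ (-2 : ℝ) := by
    intro w hw hwR
    have n1 := norm_nonneg z
    have n2 := norm_nonneg z'
    have hne : w ≠ z := by rintro rfl; linarith
    have hw1 : 1 ≤ ‖w‖ := by linarith
    have hd1 := half_norm_le_norm_sub (z := z) (w := w) (by linarith)
    have hd2 := half_norm_le_norm_sub (z := z') (w := w) (by linarith)
    rw [hGeq w hne, norm_mul, norm_div, norm_mul, norm_mul, norm_mul, Complex.norm_I,
      Complex.norm_ofNat, Complex.norm_real, Real.norm_of_nonneg ht.le, mul_one]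
    have h1 : ‖F w - F z‖ ≤ 2 * C := by
      refine (norm_sub_le _ _).trans ?_
      have := hFC w hw
      have := hFC z (by rw [hzim]; linarith)
      linarith
    have h2 : 2 * t / (‖w - z‖ * ‖w - z'‖) ≤ 2 * t / ((1 + ‖w‖) / 4 * ((1 + ‖w‖) / 4)) := by
      gcongr <;> linarith
    calc ‖F w - F z‖ * (2 * t / (‖w - z‖ * ‖w - z'‖))
        ≤ (2 * C) * (2 * t / ((1 + ‖w‖) / 4 * ((1 + ‖w‖) / 4))) := by gcongr
      _ = (64 * C * t) * (1 + ‖w‖) ^ (-2 : ℝ) := by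
        rw [Real.rpow_neg (by positivity), Real.rpow_two]
        field_simp
        ring
  obtain ⟨C', hC'⟩ := exists_decay_of_eventually hGdiff.continuousOn hGdec
  have hzero := integral_horizontal_eq_zero hε (one_lt_two) hGdiff hC'
  have hline : ∀ y : ℝ, G (y + ε * Complex.I) =
      2 * Complex.I * ((poisK t (x - y) : ℂ) * F (y + ε * Complex.I) - poisK t (x - y) * F z) := by
    intro y
    have hne : (y + ε * Complex.I : ℂ) ≠ z := by
      intro h
      have := congrArg Complex.im h
      rw [hzim] at this
      simp at this
      exact ht.ne' this
    have hprod : ((y + ε * Complex.I : ℂ) - z) * ((y + ε * Complex.I : ℂ) - z') =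
        (((x - y) ^ 2 + t ^ 2 : ℝ) : ℂ) := by
      rw [hz, hz']
      push_cast
      linear_combination (-(t : ℂ) ^ 2) * Complex.I_sq
    rw [hGeq _ hne, hprod, poisK]
    push_cast
    ring
  simp_rw [hline] at hzero
  rw [integral_const_mul, mul_eq_zero] at hzero
  have hzero := hzero.resolve_left (by simp)
  have hcont := continuous_cauchyT_horizontal hg.integrable hε
  have hi1 : Integrable fun y : ℝ => (poisK t (x - y) : ℂ) * F (y + ε * Complex.I) := by
    refine (integrable_poisK ht x).ofReal.mul_bdd (c := C) hcont.aestronglyMeasurable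
      (ae_of_all _ fun y => hFC _ (by simp))
  have hi2 : Integrable fun y : ℝ => (poisK t (x - y) : ℂ) * F z :=
    (integrable_poisK ht x).ofReal.mul_const _
  rw [integral_sub hi1 hi2, integral_mul_const, integral_complex_ofReal, integral_poisK ht,
    sub_eq_zero] at hzero
  exact hzero.symm

theorem enorm_cauchyT_le_dyadicMax (hg : BddCpt g) {ε t : ℝ} (hε : 0 < ε) (ht : ε < t) (x : ℝ) :
    ‖cauchyT g (x + t * Complex.I)‖ₑ ≤
      64 * dyadicMax (fun y => ‖cauchyT g (y + ε * Complex.I)‖ₑ) x := by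
  have hm := (continuous_cauchyT_horizontal hg.integrable hε).measurable
  have h := pi_mul_cauchyT_eq hg hε (sub_pos.2 ht) x
  rw [add_sub_cancel] at h
  calc ‖cauchyT g (x + t * Complex.I)‖ₑ
      ≤ ‖(Real.pi : ℂ) * cauchyT g (x + t * Complex.I)‖ₑ := by
        rw [enorm_le_iff_norm_le, norm_mul, Complex.norm_real, Real.norm_of_nonneg Real.pi_pos.le]
        exact le_mul_of_one_le_left (norm_nonneg _) (by linarith [Real.pi_gt_three])
    _ ≤ ∫⁻ y : ℝ, ‖(poisK (t - ε) (x - y) : ℂ) * cauchyT g (y + ε * Complex.I)‖ₑ := by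
        rw [h]
        exact enorm_integral_le_lintegral_enorm _
    _ = ∫⁻ y : ℝ, ENNReal.ofReal ((t - ε) / ((x - y) ^ 2 + (t - ε) ^ 2)) *
          ‖cauchyT g (y + ε * Complex.I)‖ₑ := by
        refine lintegral_congr fun y => ?_
        rw [enorm_mul, ← ofReal_norm, Complex.norm_real,
          Real.norm_of_nonneg (poisK_pos (sub_pos.2 ht) _).le]
        rfl
    _ ≤ _ := lintegral_poisson_le_dyadicMax (by fun_prop) (sub_pos.2 ht) x

/-- The maximal function of the Cauchy transform along vertical lines. -/
def cauchyMax (g : ℝ → ℝ) (x : ℝ) : ℝ≥0∞ :=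
  ⨆ t : Ioi (0 : ℝ), ‖cauchyT g (x + (t : ℝ) * Complex.I)‖ₑ

/-- An uncountable supremum of continuous functions is lower semicontinuous. -/
theorem measurable_cauchyMax (hg : Integrable g) : Measurable (cauchyMax g) :=
  (lowerSemicontinuous_iSup fun t : Ioi (0 : ℝ) =>
    (continuous_cauchyT_horizontal hg t.2).enorm.lowerSemicontinuous).measurable

theorem lintegral_cauchyMax_rpow_le {p : ℝ} (hp : 1 < p) :
    ∃ K : NNReal, ∀ g : ℝ → ℝ, BddCpt g →
      ∫⁻ x : ℝ, cauchyMax g x ^ p ≤ K * ∫⁻ x, ‖g x‖ₑ ^ p := by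
  have hp0 : 0 < p := by linarith
  obtain ⟨K, hK⟩ := lintegral_cauchyT_rpow_le hp
  refine ⟨64 ^ p * ((20 * p * 4 ^ (p - 1) / (p - 1)).toNNReal * K), fun g hg => ?_⟩
  set ε : ℕ → ℝ := fun n => 1 / ((n : ℝ) + 1) with hε
  have hε0 : ∀ n, 0 < ε n := fun n => by simp only [hε]; positivity
  set u : ℕ → ℝ → ℝ≥0∞ := fun n x =>
    64 * dyadicMax (fun y => ‖cauchyT g (y + (ε n : ℝ) * Complex.I)‖ₑ) x with hu
  have hm : ∀ n, Measurable fun y : ℝ => ‖cauchyT g (y + (ε n : ℝ) * Complex.I)‖ₑ := fun n =>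
    (continuous_cauchyT_horizontal hg.integrable (hε0 n)).measurable.enorm
  have hum : ∀ n, Measurable (u n) := fun n => (measurable_dyadicMax (hm n)).const_mul _
  -- For fixed `t` the height `ε n` is eventually below `t`, so each value is dominated by `u n x`
  -- for all large `n`. Fatou then needs no monotonicity in `n`.
  have hle : ∀ x, cauchyMax g x ≤ liminf (fun n => u n x) atTop := by
    intro x
    refine iSup_le fun t => ?_
    refine le_liminf_of_le (by isBoundedDefault) ?_
    have := (tendsto_one_div_add_atTop_nhds_zero_nat (𝕜 := ℝ)).eventually (gt_mem_nhds t.2)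
    filter_upwards [this] with n hn
    exact enorm_cauchyT_le_dyadicMax hg (hε0 n) hn x
  calc ∫⁻ x : ℝ, cauchyMax g x ^ p
      ≤ ∫⁻ x : ℝ, liminf (fun n => u n x ^ p) atTop := by
        refine lintegral_mono fun x => ?_
        refine (ENNReal.rpow_le_rpow (hle x) hp0.le).trans (le_of_eq ?_)
        exact (ENNReal.orderIsoRpow p hp0).liminf_apply
    _ ≤ liminf (fun n => ∫⁻ x : ℝ, u n x ^ p) atTop :=
        lintegral_liminf_le fun n => (hum n).pow_const p
    _ ≤ liminf (fun _ : ℕ => 64 ^ p * (ENNReal.ofReal (20 * p * 4 ^ (p - 1) / (p - 1)) *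
          (K * ∫⁻ x, ‖g x‖ₑ ^ p))) atTop := by
        refine liminf_le_liminf (Eventually.of_forall fun n => ?_)
        simp only [hu]
        simp_rw [ENNReal.mul_rpow_of_nonneg _ _ hp0.le]
        rw [lintegral_const_mul _ ((measurable_dyadicMax (hm n)).pow_const p)]
        gcongr
        refine (lintegral_dyadicMax_rpow_le hp (hm n)).trans ?_
        gcongr
        exact hK g hg _ (hε0 n)
    _ = _ := by
        rw [liminf_const, ENNReal.coe_mul, ENNReal.coe_mul, ENNReal.coe_rpow_of_nonneg _ hp0.le,
          ENNReal.coe_ofNat, mul_assoc ((64 : ℝ≥0∞) ^ p), mul_assoc (_ : ℝ≥0∞) (K : ℝ≥0∞)]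
        rfl

end

/-! ### Absolute convergence of truncated singular integrals -/

section Convergence

variable {E : Type*} [NormedAddCommGroup E] [NormedSpace ℝ E] [FiniteDimensional ℝ E]
  [MeasurableSpace E] [BorelSpace E] {μ : Measure E} [μ.IsAddHaarMeasure]

/-- Away from the origin the kernel is comparable to a power of `1 + ‖y‖` with exponent `-d * q`,
which is integrable because `d * q > d`. With Hölder this yields absolute convergence. -/
theorem memLp_indicator_norm_pow_inv {q t : ℝ} (hq : 1 < q) (ht : 0 < t)
    (hd : 0 < Module.finrank ℝ E) :
    MemLp ({y : E | t < ‖y‖}.indicator fun y => (‖y‖ ^ Module.finrank ℝ E)⁻¹)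
      (ENNReal.ofReal q) μ := by
  set d := Module.finrank ℝ E with hdE
  have hq0 : 0 < q := by linarith
  have hs : MeasurableSet {y : E | t < ‖y‖} := measurableSet_lt measurable_const measurable_norm
  have hm : Measurable ({y : E | t < ‖y‖}.indicator fun y => (‖y‖ ^ d)⁻¹) :=
    Measurable.indicator (by fun_prop) hs
  rw [← integrable_norm_rpow_iff hm.aestronglyMeasurable (by simpa using hq0)
    ENNReal.ofReal_ne_top, ENNReal.toReal_ofReal hq0.le]
  have hd' : (Module.finrank ℝ E : ℝ) < d * q := by
    have : (0 : ℝ) < d := by exact_mod_cast hd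
    nlinarith
  set c := (1 + t⁻¹) ^ (d * q) with hc
  refine ((integrable_one_add_norm (μ := μ) hd').const_mul c).mono'
    (hm.norm.pow_const q).aestronglyMeasurable (ae_of_all _ fun y => ?_)
  rw [Real.norm_of_nonneg (by positivity)]
  by_cases hy : t < ‖y‖
  · rw [indicator_of_mem (by exact hy)]
    have hy0 : 0 < ‖y‖ := ht.trans hy
    rw [Real.norm_of_nonneg (by positivity), Real.inv_rpow (by positivity), ← Real.rpow_natCast,
      ← Real.rpow_mul hy0.le, Real.rpow_neg (by positivity), hc, ← div_eq_mul_inv,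
      inv_eq_one_div, div_le_div_iff₀ (by positivity) (by positivity), one_mul,
      ← Real.mul_rpow (by positivity) hy0.le]
    refine Real.rpow_le_rpow (by positivity) ?_ (by positivity)
    have : 1 ≤ t⁻¹ * ‖y‖ := by
      rw [inv_mul_eq_div, one_le_div ht]
      exact hy.le
    linarith
  · rw [indicator_of_notMem (by exact hy)]
    simp only [norm_zero, Real.zero_rpow hq0.ne']
    positivity

theorem integrableOn_norm_pow_inv_mul {p t : ℝ} (hp : 1 < p) (ht : 0 < t)
    (hd : 0 < Module.finrank ℝ E) {f : E → ℂ} (hf : MemLp f (ENNReal.ofReal p) μ) (x : E) :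
    IntegrableOn (fun y => (‖y‖ ^ Module.finrank ℝ E)⁻¹ • f (x - y)) {y | t < ‖y‖} μ := by
  have hs : MeasurableSet {y : E | t < ‖y‖} := measurableSet_lt measurable_const measurable_norm
  have hpq := Real.HolderConjugate.conjExponent hp
  have hf' : MemLp (fun y => f (x - y)) (ENNReal.ofReal p) μ :=
    hf.comp_measurePreserving (Measure.measurePreserving_sub_left μ x)
  have hk := memLp_indicator_norm_pow_inv (μ := μ) hpq.symm.lt ht hd
  rw [← integrable_indicator_iff hs]
  have : ENNReal.HolderTriple (ENNReal.ofReal p.conjExponent) (ENNReal.ofReal p) 1 :=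
    hpq.symm.ennrealOfReal
  have := memLp_one_iff_integrable.1 (hf'.smul hk (r := 1))
  refine this.congr (ae_of_all _ fun y => ?_)
  by_cases hy : y ∈ {y : E | t < ‖y‖}
  · simp only [Pi.smul_apply', indicator_of_mem hy]
  · simp only [Pi.smul_apply', indicator_of_notMem hy, zero_smul]

end Convergence

/-! ### The maximal truncated Hilbert transform -/

/-- The truncated Hilbert transform, written over a half-line. -/
def truncH (t : ℝ) (g : ℝ → ℂ) (x : ℝ) : ℂ :=
  ∫ r in Ioi t, (r⁻¹ : ℝ) • (g (x - r) - g (x + r))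

/-- The maximal truncated Hilbert transform. -/
def hilbertMax (g : ℝ → ℂ) (x : ℝ) : ℝ≥0∞ := ⨆ t : Ioi (0 : ℝ), ‖truncH t g x‖ₑ

/-- The kernel of the truncated Hilbert transform. -/
def truncK (t r : ℝ) : ℝ := {r : ℝ | t < |r|}.indicator (fun r => r⁻¹) r

@[fun_prop] theorem measurable_truncK (t : ℝ) : Measurable (truncK t) :=
  Measurable.indicator (by fun_prop) (measurableSet_lt measurable_const (by fun_prop))

/-- For `|r| > t` the difference has absolute value `t ^ 2 / (|r| * (r ^ 2 + t ^ 2))`; for `|r| ≤ t`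
it is `|r| / (r ^ 2 + t ^ 2)`. Sharp truncation may thus be replaced by a smooth one at the same
scale, up to a Poisson average. -/
theorem abs_truncK_sub_conjK_le {t : ℝ} (ht : 0 < t) (r : ℝ) :
    |truncK t r - conjK t r| ≤ poisK t r := by
  unfold conjK poisK
  have hD : 0 < r ^ 2 + t ^ 2 := by positivity
  by_cases h : t < |r|
  · have hr : r ≠ 0 := fun h0 => by rw [h0, abs_zero] at h; linarith
    have hr' : 0 < |r| := ht.trans h
    rw [truncK, indicator_of_mem (by exact h)]
    have : r⁻¹ - r / (r ^ 2 + t ^ 2) = t ^ 2 / (r * (r ^ 2 + t ^ 2)) := by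
      field_simp
      ring
    rw [this, abs_div, abs_mul, abs_of_pos hD, abs_of_pos (by positivity : 0 < t ^ 2),
      div_le_div_iff₀ (by positivity) hD]
    nlinarith [mul_le_mul_of_nonneg_left h.le (mul_pos ht hD).le]
  · rw [truncK, indicator_of_notMem (by exact h), zero_sub, abs_neg, abs_div, abs_of_pos hD]
    gcongr
    exact not_lt.1 h

theorem abs_truncK_le {t : ℝ} (ht : 0 < t) (r : ℝ) : |truncK t r| ≤ t⁻¹ := by
  by_cases h : t < |r|
  · rw [truncK, indicator_of_mem (by exact h), abs_inv]
    gcongr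
  · rw [truncK, indicator_of_notMem (by exact h), abs_zero]
    positivity

theorem truncH_eq {t : ℝ} (ht : 0 < t) {g : ℝ → ℂ} {x : ℝ}
    (h : Integrable fun s => truncK t (x - s) • g s) :
    truncH t g x = ∫ s, truncK t (x - s) • g s := by
  set H : ℝ → ℂ := fun u => truncK t u • g (x - u) with hH
  have hHi : Integrable H := by
    have := h.comp_sub_left x
    simpa [hH] using this
  have h1 : ∫ s, truncK t (x - s) • g s = ∫ u, H u := by
    rw [← integral_sub_left_eq_self (fun s => truncK t (x - s) • g s) volume x]
    simp [hH]
  have hneg : ∀ u, H (-u) = -(truncK t u • g (x + u)) := by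
    intro u
    simp only [hH, truncK, sub_neg_eq_add]
    by_cases hu : t < |u|
    · have hu' : t < |-u| := by rwa [abs_neg]
      rw [indicator_of_mem (by exact hu'), indicator_of_mem (by exact hu), inv_neg, neg_smul]
    · have hu' : ¬ t < |-u| := by rwa [abs_neg]
      rw [indicator_of_notMem (by exact hu'), indicator_of_notMem (by exact hu), zero_smul,
        neg_zero]
  have hHn : Integrable fun u => H (-u) := hHi.comp_neg
  have h2 : ∫ u, H u = ∫ u in Ioi (0 : ℝ), truncK t u • (g (x - u) - g (x + u)) := by
    rw [← intervalIntegral.integral_Iic_add_Ioi (b := (0 : ℝ)) hHi.integrableOn hHi.integrableOn]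
    have h3 := integral_comp_neg_Ioi (0 : ℝ) H
    rw [neg_zero] at h3
    rw [← h3, ← integral_add hHn.integrableOn hHi.integrableOn]
    refine integral_congr_ae (ae_of_all _ fun u => ?_)
    simp only [hneg]
    rw [smul_sub, neg_add_eq_sub]
  rw [h1, h2, truncH]
  have hsub : Ioi t ⊆ Ioi (0 : ℝ) := Ioi_subset_Ioi ht.le
  rw [← inter_eq_self_of_subset_right hsub, ← setIntegral_indicator measurableSet_Ioi]
  refine setIntegral_congr_fun measurableSet_Ioi fun u hu => ?_
  simp only [truncK]
  by_cases h : u ∈ Ioi t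
  · rw [indicator_of_mem h, indicator_of_mem (by
      exact (mem_Ioi.1 h).trans_le (le_abs_self u) : u ∈ {r : ℝ | t < |r|})]
  · rw [indicator_of_notMem h, indicator_of_notMem (by
      simpa [abs_of_pos (mem_Ioi.1 hu)] using h : u ∉ {r : ℝ | t < |r|}), zero_smul]

/-- A measurable majorant of the maximal truncated Hilbert transform of a real function. -/
def hilbertMajorant (g : ℝ → ℝ) (x : ℝ) : ℝ≥0∞ :=
  cauchyMax g x + 64 * dyadicMax (fun y => ‖g y‖ₑ) x

theorem measurable_hilbertMajorant {g : ℝ → ℝ} (hg : BddCpt g) : Measurable (hilbertMajorant g) :=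
  (measurable_cauchyMax hg.integrable).add
    ((measurable_dyadicMax hg.meas.enorm).const_mul _)

theorem enorm_truncH_ofReal_le {g : ℝ → ℝ} (hg : BddCpt g) {t : ℝ} (ht : 0 < t) (x : ℝ) :
    ‖truncH t (fun s => (g s : ℂ)) x‖ₑ ≤ hilbertMajorant g x := by
  have hgi := hg.integrable
  have hi : Integrable fun s => truncK t (x - s) * g s :=
    hgi.bdd_mul (c := t⁻¹) (Measurable.aestronglyMeasurable (by fun_prop))
      (ae_of_all _ fun s => abs_truncK_le ht _)
  have hi' : Integrable fun s => truncK t (x - s) • (g s : ℂ) := by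
    refine hi.ofReal.congr (ae_of_all _ fun s => ?_)
    simp
  have h1 : truncH t (fun s => (g s : ℂ)) x = ((∫ s, truncK t (x - s) * g s : ℝ) : ℂ) := by
    rw [truncH_eq ht hi', ← integral_complex_ofReal]
    refine integral_congr_ae (ae_of_all _ fun s => ?_)
    simp
  have h2 : ∫ s, truncK t (x - s) * g s =
      conjI t g x + ∫ s, (truncK t (x - s) - conjK t (x - s)) * g s := by
    rw [conjI, ← integral_add (integrable_conjK_mul hgi ht x)]
    · refine integral_congr_ae (ae_of_all _ fun s => ?_)
      simp only
      ring
    · refine (hi.sub (integrable_conjK_mul hgi ht x)).congr (ae_of_all _ fun s => ?_)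
      simp only [Pi.sub_apply]
      ring
  have h3 : ‖∫ s, (truncK t (x - s) - conjK t (x - s)) * g s‖ₑ ≤
      64 * dyadicMax (fun y => ‖g y‖ₑ) x := by
    refine (enorm_integral_le_lintegral_enorm _).trans ?_
    refine le_trans ?_ (lintegral_poisson_le_dyadicMax hg.meas.enorm ht x)
    refine lintegral_mono fun s => ?_
    rw [enorm_mul]
    gcongr
    rw [← ofReal_norm]
    exact ENNReal.ofReal_le_ofReal (abs_truncK_sub_conjK_le ht _)
  rw [h1, h2, ← ofReal_norm, Complex.norm_real, ofReal_norm]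
  refine (enorm_add_le _ _).trans (add_le_add ?_ h3)
  exact (enorm_conjI_le hgi ht x).trans
    (le_iSup (fun t : Ioi (0 : ℝ) => ‖cauchyT g (x + (t : ℝ) * Complex.I)‖ₑ) ⟨t, ht⟩)

theorem lintegral_hilbertMajorant_rpow_le {p : ℝ} (hp : 1 < p) :
    ∃ K : NNReal, ∀ g : ℝ → ℝ, BddCpt g →
      ∫⁻ x : ℝ, hilbertMajorant g x ^ p ≤ K * ∫⁻ x, ‖g x‖ₑ ^ p := by
  have hp0 : 0 < p := by linarith
  obtain ⟨K, hK⟩ := lintegral_cauchyMax_rpow_le hp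
  set D := (20 * p * 4 ^ (p - 1) / (p - 1)).toNNReal with hD
  refine ⟨2 ^ (p - 1) * (K + 64 ^ p * D), fun g hg => ?_⟩
  have hm1 := measurable_cauchyMax hg.integrable
  have hm2 := measurable_dyadicMax hg.meas.enorm
  calc ∫⁻ x : ℝ, hilbertMajorant g x ^ p
      ≤ ∫⁻ x : ℝ, 2 ^ (p - 1) * (cauchyMax g x ^ p +
          64 ^ p * dyadicMax (fun y => ‖g y‖ₑ) x ^ p) := by
        refine lintegral_mono fun x => ?_
        refine (ENNReal.rpow_add_le_mul_rpow_add_rpow _ _ hp.le).trans (le_of_eq ?_)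
        rw [ENNReal.mul_rpow_of_nonneg _ _ hp0.le]
    _ = 2 ^ (p - 1) * ((∫⁻ x : ℝ, cauchyMax g x ^ p) +
          64 ^ p * ∫⁻ x : ℝ, dyadicMax (fun y => ‖g y‖ₑ) x ^ p) := by
        rw [lintegral_const_mul _ (by fun_prop), lintegral_add_left (by fun_prop),
          lintegral_const_mul _ (by fun_prop)]
    _ ≤ 2 ^ (p - 1) * (K * (∫⁻ x, ‖g x‖ₑ ^ p) + 64 ^ p * (D * ∫⁻ x, ‖g x‖ₑ ^ p)) := by
        gcongr
        · exact hK g hg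
        · exact lintegral_dyadicMax_rpow_le hp hg.meas.enorm
    _ = _ := by
        rw [ENNReal.coe_mul, ENNReal.coe_rpow_of_nonneg _ (by linarith), ENNReal.coe_add,
          ENNReal.coe_ofNat, ENNReal.coe_mul, ENNReal.coe_rpow_of_nonneg _ hp0.le,
          ENNReal.coe_ofNat]
        ring

theorem integrableOn_truncH {p : ℝ} (hp : 1 < p) {g : ℝ → ℂ}
    (hg : MemLp g (ENNReal.ofReal p) volume) {t : ℝ} (ht : 0 < t) (x : ℝ) :
    IntegrableOn (fun r => ‖(r⁻¹ : ℝ) • g (x - r)‖ + ‖(r⁻¹ : ℝ) • g (x + r)‖) (Ioi t) := by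
  have hd : 0 < Module.finrank ℝ ℝ := by simp
  have hsub : Ioi t ⊆ {y : ℝ | t < ‖y‖} := fun r hr => lt_of_lt_of_le hr (le_abs_self r)
  have hmono : ∀ (f : ℝ → ℂ), MemLp f (ENNReal.ofReal p) volume → ∀ x,
      IntegrableOn (fun r => (r⁻¹ : ℝ) • f (x - r)) (Ioi t) := by
    intro f hf x
    have h1 := (integrableOn_norm_pow_inv_mul hp ht hd hf x).mono_set hsub
    refine h1.congr_fun (fun r hr => ?_) measurableSet_Ioi
    simp [abs_of_pos (ht.trans hr)]
  have h1 := hmono g hg x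
  have h2 := hmono (fun y => g (-y)) (hg.comp_measurePreserving (Measure.measurePreserving_neg _))
    (-x)
  have h2' : IntegrableOn (fun r => (r⁻¹ : ℝ) • g (x + r)) (Ioi t) := by
    refine h2.congr_fun (fun r _ => ?_) measurableSet_Ioi
    simp only [neg_sub, sub_neg_eq_add, add_comm]
  exact h1.norm.add h2'.norm

/-- Truncation of a function in size and in support. -/
def cutoff (n : ℕ) (g : ℝ → ℂ) : ℝ → ℂ := {s | ‖g s‖ ≤ n ∧ |s| ≤ n}.indicator g

theorem norm_cutoff_le (n : ℕ) (g : ℝ → ℂ) (s : ℝ) : ‖cutoff n g s‖ ≤ ‖g s‖ :=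
  norm_indicator_le_norm_self _ _

theorem tendsto_cutoff (g : ℝ → ℂ) (s : ℝ) :
    Tendsto (fun n => cutoff n g s) atTop (𝓝 (g s)) := by
  obtain ⟨N, hN⟩ := exists_nat_ge (max ‖g s‖ |s|)
  refine tendsto_const_nhds.congr' ?_
  filter_upwards [eventually_ge_atTop N] with n hn
  have : (N : ℝ) ≤ n := by exact_mod_cast hn
  rw [cutoff, indicator_of_mem]
  exact ⟨(le_max_left _ _).trans (hN.trans this), (le_max_right _ _).trans (hN.trans this)⟩

theorem measurable_cutoff (n : ℕ) {g : ℝ → ℂ} (hg : Measurable g) : Measurable (cutoff n g) :=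
  hg.indicator ((measurableSet_le hg.norm measurable_const).inter
    (measurableSet_le measurable_norm measurable_const))

theorem bddCpt_cutoff (n : ℕ) {g : ℝ → ℂ} (hg : Measurable g) {L : ℂ → ℝ} (hL : Measurable L)
    (hL' : ∀ z, |L z| ≤ ‖z‖) : BddCpt fun s => L (cutoff n g s) := by
  refine ⟨hL.comp (measurable_cutoff n hg), ⟨n, fun s => (hL' _).trans ?_⟩, n, fun s hs => ?_⟩
  · by_cases h : s ∈ {s | ‖g s‖ ≤ n ∧ |s| ≤ n}
    · rw [cutoff, indicator_of_mem h]
      exact h.1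
    · rw [cutoff, indicator_of_notMem h, norm_zero]
      positivity
  · have : cutoff n g s = 0 := indicator_of_notMem (fun h => absurd h.2 (not_le.2 hs)) _
    have h2 := hL' (cutoff n g s)
    rw [this, norm_zero] at h2
    rw [this]
    exact abs_nonpos_iff.1 h2

theorem enorm_truncH_cutoff_le {n : ℕ} {g : ℝ → ℂ} (hg : Measurable g) {t : ℝ} (ht : 0 < t)
    (x : ℝ) : ‖truncH t (cutoff n g) x‖ₑ ≤
      hilbertMajorant (fun s => (cutoff n g s).re) x +
        hilbertMajorant (fun s => (cutoff n g s).im) x := by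
  have hre := bddCpt_cutoff n hg Complex.measurable_re Complex.abs_re_le_norm
  have him := bddCpt_cutoff n hg Complex.measurable_im Complex.abs_im_le_norm
  have hi : ∀ f : ℝ → ℝ, BddCpt f → IntegrableOn
      (fun r => (r⁻¹ : ℝ) • ((f (x - r) : ℂ) - (f (x + r) : ℂ))) (Ioi t) := by
    intro f hf
    have h1 : Integrable fun r => (f (x - r) : ℂ) - (f (x + r) : ℂ) :=
      (hf.integrable.comp_sub_left x).ofReal.sub (hf.integrable.comp_add_left x).ofReal
    refine Integrable.bdd_smul (φ := fun r : ℝ => r⁻¹) h1.integrableOn t⁻¹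
      (Measurable.aestronglyMeasurable (by fun_prop)) ?_
    filter_upwards [ae_restrict_mem measurableSet_Ioi] with r hr
    rw [Real.norm_of_nonneg (inv_nonneg.2 (ht.trans hr).le)]
    exact inv_anti₀ ht (le_of_lt hr)
  have hsplit : truncH t (cutoff n g) x =
      truncH t (fun s => ((cutoff n g s).re : ℂ)) x +
        truncH t (fun s => ((cutoff n g s).im : ℂ)) x * Complex.I := by
    unfold truncH
    rw [← integral_mul_const, ← integral_add (hi _ hre) ((hi _ him).mul_const _)]
    refine integral_congr_ae (ae_of_all _ fun r => ?_)
    simp only [Complex.real_smul]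
    conv_lhs => rw [← Complex.re_add_im (cutoff n g (x - r)), ← Complex.re_add_im (cutoff n g (x + r))]
    ring
  rw [hsplit]
  refine (enorm_add_le _ _).trans (add_le_add (enorm_truncH_ofReal_le hre ht x) ?_)
  rw [enorm_mul, ← ofReal_norm Complex.I, Complex.norm_I, ENNReal.ofReal_one, mul_one]
  exact enorm_truncH_ofReal_le him ht x

/-- The majorant is available only for bounded real functions of bounded support. For each fixed `t`
the truncated integrals of the cutoffs converge by domination, and the liminf makes the bound
uniform in `t`. -/
theorem hilbertMax_le_liminf {p : ℝ} (hp : 1 < p) {g : ℝ → ℂ} (hgm : Measurable g)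
    (hg : MemLp g (ENNReal.ofReal p) volume) (x : ℝ) :
    hilbertMax g x ≤ liminf (fun n : ℕ => hilbertMajorant (fun s => (cutoff n g s).re) x +
        hilbertMajorant (fun s => (cutoff n g s).im) x) atTop := by
  refine iSup_le fun ⟨t, ht⟩ => ?_
  have ht : 0 < t := ht
  have hlim : Tendsto (fun n => truncH t (cutoff n g) x) atTop (𝓝 (truncH t g x)) := by
    refine tendsto_integral_of_dominated_convergence _ (fun n => ?_)
      (integrableOn_truncH hp hg ht x) (fun n => ae_of_all _ fun r => ?_)
      (ae_of_all _ fun r => ?_)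
    · have := measurable_cutoff n hgm
      exact Measurable.aestronglyMeasurable (by fun_prop)
    · rw [smul_sub]
      refine (norm_sub_le _ _).trans ?_
      rw [norm_smul, norm_smul, norm_smul, norm_smul]
      gcongr
      · exact norm_cutoff_le n g _
      · exact norm_cutoff_le n g _
    · exact ((tendsto_cutoff g _).sub (tendsto_cutoff g _)).const_smul _
  calc ‖truncH t g x‖ₑ = liminf (fun n => ‖truncH t (cutoff n g) x‖ₑ) atTop :=
        ((continuous_enorm.tendsto _).comp hlim).liminf_eq.symm
    _ ≤ _ := liminf_le_liminf (Eventually.of_forall fun n => enorm_truncH_cutoff_le hgm ht x)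

/-- The maximal truncated Hilbert transform is bounded on `L^p`, `1 < p < ∞`. -/
theorem lintegral_hilbertMax_rpow_le {p : ℝ} (hp : 1 < p) :
    ∃ K : NNReal, 0 < K ∧ ∀ g : ℝ → ℂ, Measurable g →
      ∫⁻ x : ℝ, hilbertMax g x ^ p ≤ K * ∫⁻ x, ‖g x‖ₑ ^ p := by
  have hp0 : 0 < p := by linarith
  obtain ⟨K, hK⟩ := lintegral_hilbertMajorant_rpow_le hp
  -- The added 1 makes the constant positive, also settling the case of infinite norm.
  refine ⟨2 ^ (p - 1) * (K + K) + 1, by positivity, fun g hg => ?_⟩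
  rcases eq_or_ne (∫⁻ x, ‖g x‖ₑ ^ p) ⊤ with htop | htop
  · rw [htop, ENNReal.mul_top (by simp)]
    exact le_top
  have hgL : MemLp g (ENNReal.ofReal p) volume := by
    refine ⟨hg.aestronglyMeasurable, ?_⟩
    rw [eLpNorm_lt_top_iff_lintegral_rpow_enorm_lt_top (by simpa using hp0) ENNReal.ofReal_ne_top,
      ENNReal.toReal_ofReal hp0.le]
    exact htop.lt_top
  have hre : ∀ n, BddCpt fun s => (cutoff n g s).re := fun n =>
    bddCpt_cutoff n hg Complex.measurable_re Complex.abs_re_le_norm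
  have him : ∀ n, BddCpt fun s => (cutoff n g s).im := fun n =>
    bddCpt_cutoff n hg Complex.measurable_im Complex.abs_im_le_norm
  have hmono : ∀ (n : ℕ) (L : ℂ → ℝ), (∀ z, |L z| ≤ ‖z‖) →
      ∫⁻ x, ‖L (cutoff n g x)‖ₑ ^ p ≤ ∫⁻ x, ‖g x‖ₑ ^ p := by
    intro n L hL
    gcongr with x
    rw [enorm_le_iff_norm_le]
    exact (hL _).trans (norm_cutoff_le n g x)
  calc ∫⁻ x : ℝ, hilbertMax g x ^ p
      ≤ ∫⁻ x : ℝ, liminf (fun n : ℕ => (hilbertMajorant (fun s => (cutoff n g s).re) x +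
        hilbertMajorant (fun s => (cutoff n g s).im) x) ^ p) atTop := by
        refine lintegral_mono fun x => ?_
        refine (ENNReal.rpow_le_rpow (hilbertMax_le_liminf hp hg hgL x) hp0.le).trans (le_of_eq ?_)
        exact (ENNReal.orderIsoRpow p hp0).liminf_apply
    _ ≤ liminf (fun n : ℕ => ∫⁻ x : ℝ, (hilbertMajorant (fun s => (cutoff n g s).re) x +
        hilbertMajorant (fun s => (cutoff n g s).im) x) ^ p) atTop :=
        lintegral_liminf_le fun n => ((measurable_hilbertMajorant (hre n)).add
          (measurable_hilbertMajorant (him n))).pow_const p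
    _ ≤ liminf (fun _ : ℕ => 2 ^ (p - 1) * (K * (∫⁻ x, ‖g x‖ₑ ^ p) +
          K * ∫⁻ x, ‖g x‖ₑ ^ p)) atTop := by
        refine liminf_le_liminf (Eventually.of_forall fun n => ?_)
        have hm1 := measurable_hilbertMajorant (hre n)
        have hm2 := measurable_hilbertMajorant (him n)
        calc ∫⁻ x : ℝ, (hilbertMajorant (fun s => (cutoff n g s).re) x +
              hilbertMajorant (fun s => (cutoff n g s).im) x) ^ p
            ≤ ∫⁻ x : ℝ, 2 ^ (p - 1) * (hilbertMajorant (fun s => (cutoff n g s).re) x ^ p +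
              hilbertMajorant (fun s => (cutoff n g s).im) x ^ p) :=
              lintegral_mono fun x => ENNReal.rpow_add_le_mul_rpow_add_rpow _ _ hp.le
          _ = 2 ^ (p - 1) * ((∫⁻ x : ℝ, hilbertMajorant (fun s => (cutoff n g s).re) x ^ p) +
              ∫⁻ x : ℝ, hilbertMajorant (fun s => (cutoff n g s).im) x ^ p) := by
              rw [lintegral_const_mul _ (by fun_prop), lintegral_add_left (by fun_prop)]
          _ ≤ _ := by
              gcongr
              · exact (hK _ (hre n)).trans
                  (mul_le_mul_right (hmono n _ Complex.abs_re_le_norm) _)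
              · exact (hK _ (him n)).trans
                  (mul_le_mul_right (hmono n _ Complex.abs_im_le_norm) _)
    _ ≤ _ := by
        rw [liminf_const, ENNReal.coe_add, ENNReal.coe_mul, ENNReal.coe_add,
          ENNReal.coe_rpow_of_nonneg _ (by linarith), ENNReal.coe_ofNat, add_mul, ← add_mul,
          mul_assoc]
        exact le_self_add

/-! ### Integration in polar coordinates -/

section Polar

theorem homeomorphUnitSphereProd_smul {E : Type*} [NormedAddCommGroup E] [NormedSpace ℝ E]
    (x : ({0}ᶜ : Set E)) :
    ((homeomorphUnitSphereProd E x).2 : ℝ) • ((homeomorphUnitSphereProd E x).1 : E) = x := by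
  rw [← homeomorphUnitSphereProd_symm_apply_coe, Homeomorph.symm_apply_apply]

variable {E : Type*} [NormedAddCommGroup E] [NormedSpace ℝ E] [FiniteDimensional ℝ E]
  [Nontrivial E] [MeasurableSpace E] [BorelSpace E] (μ : Measure E) [μ.IsAddHaarMeasure]

theorem lintegral_eq_lintegral_prod_toSphere (Φ : E → ℝ≥0∞) :
    ∫⁻ x, Φ x ∂μ = ∫⁻ q : sphere (0 : E) 1 × Ioi (0 : ℝ), Φ ((q.2 : ℝ) • (q.1 : E))
      ∂(μ.toSphere.prod (.volumeIoiPow (Module.finrank ℝ E - 1))) := by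
  calc ∫⁻ x, Φ x ∂μ = ∫⁻ x : ({(0)}ᶜ : Set E), Φ x ∂(μ.comap (↑)) := by
        rw [lintegral_subtype_comap (measurableSet_singleton _).compl, restrict_compl_singleton]
    _ = _ := by
        rw [← μ.measurePreserving_homeomorphUnitSphereProd.lintegral_comp_emb
          (Homeomorph.measurableEmbedding _)]
        simp_rw [homeomorphUnitSphereProd_smul]

theorem lintegral_polar {Φ : E → ℝ≥0∞} (hΦ : Measurable Φ) :
    ∫⁻ x, Φ x ∂μ = ∫⁻ θ : sphere (0 : E) 1, (∫⁻ r in Ioi (0 : ℝ),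
      ENNReal.ofReal (r ^ (Module.finrank ℝ E - 1)) * Φ (r • (θ : E))) ∂μ.toSphere := by
  rw [lintegral_eq_lintegral_prod_toSphere, lintegral_prod _ (by fun_prop)]
  refine lintegral_congr fun θ => ?_
  simp only
  rw [Measure.volumeIoiPow, lintegral_withDensity_eq_lintegral_mul _ (by fun_prop) (by fun_prop),
    ← lintegral_subtype_comap measurableSet_Ioi]
  rfl

theorem integral_polar {F : Type*} [NormedAddCommGroup F] [NormedSpace ℝ F] {Φ : E → F}
    (hΦ : Integrable Φ μ) :
    ∫ x, Φ x ∂μ = ∫ θ : sphere (0 : E) 1, (∫ r in Ioi (0 : ℝ),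
      r ^ (Module.finrank ℝ E - 1) • Φ (r • (θ : E))) ∂μ.toSphere := by
  have hmp := μ.measurePreserving_homeomorphUnitSphereProd
  have hemb : MeasurableEmbedding (homeomorphUnitSphereProd E) := Homeomorph.measurableEmbedding _
  set Ψ : sphere (0 : E) 1 × Ioi (0 : ℝ) → F := fun q => Φ ((q.2 : ℝ) • (q.1 : E)) with hΨ
  have hΨc : Ψ ∘ homeomorphUnitSphereProd E = fun x : ({(0)}ᶜ : Set E) => Φ x := by
    funext x
    simp only [hΨ, Function.comp, homeomorphUnitSphereProd_smul]
  have hΨi : Integrable Ψ (μ.toSphere.prod (.volumeIoiPow (Module.finrank ℝ E - 1))) := by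
    rw [← hmp.integrable_comp_emb hemb, hΨc]
    exact (integrableOn_iff_comap_subtypeVal (measurableSet_singleton _).compl).1 hΦ.integrableOn
  calc ∫ x, Φ x ∂μ = ∫ x : ({(0)}ᶜ : Set E), Φ x ∂(μ.comap (↑)) := by
        rw [integral_subtype_comap (measurableSet_singleton _).compl, restrict_compl_singleton]
    _ = ∫ q, Ψ q ∂(μ.toSphere.prod (.volumeIoiPow (Module.finrank ℝ E - 1))) := by
        rw [← hmp.integral_comp hemb]
        exact congrArg (fun h => ∫ x, h x ∂(μ.comap (↑))) hΨc.symm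
    _ = _ := by
        rw [integral_prod _ hΨi]
        refine integral_congr_ae (ae_of_all _ fun θ => ?_)
        simp only [hΨ, Measure.volumeIoiPow, ENNReal.ofReal]
        rw [integral_withDensity_eq_integral_smul
          (measurable_subtype_coe.pow_const _).real_toNNReal,
          integral_subtype_comap measurableSet_Ioi
            fun r : ℝ => Real.toNNReal (r ^ (Module.finrank ℝ E - 1)) • Φ (r • (θ : E))]
        refine setIntegral_congr_fun measurableSet_Ioi fun r hr => ?_
        rw [NNReal.smul_def, Real.coe_toNNReal _ (pow_nonneg hr.out.le _)]

end Polar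

/-! ### Integration along lines -/

section Lines

variable {E : Type*} [NormedAddCommGroup E] [InnerProductSpace ℝ E] [FiniteDimensional ℝ E]
  [MeasurableSpace E] [BorelSpace E] (μ : Measure E) [μ.IsAddHaarMeasure]

/-- A slab which meets every line in direction `θ` in a segment of length one. -/
def unitSlab (θ : E) : Set E := {x | inner ℝ x θ ∈ Icc (0 : ℝ) 1}

theorem measurableSet_unitSlab (θ : E) : MeasurableSet (unitSlab θ) :=
  measurableSet_Icc.preimage (Measurable.inner_const measurable_id)

/-- Fubini along lines without choosing coordinates: after swapping the integrals and translating by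
`s • θ`, the parameters `s` with `x - s • θ` in the slab form an interval of length one. -/
theorem lintegral_eq_lintegral_unitSlab_lines {θ : E} (hθ : ‖θ‖ = 1) {G : E → ℝ≥0∞}
    (hG : Measurable G) :
    ∫⁻ x, G x ∂μ = ∫⁻ x in unitSlab θ, (∫⁻ s : ℝ, G (x + s • θ)) ∂μ := by
  have hS := measurableSet_unitSlab θ
  have hmeas : Measurable fun q : E × ℝ => (unitSlab θ).indicator 1 q.1 * G (q.1 + q.2 • θ) :=
    ((measurable_one.indicator hS).comp measurable_fst).mul (by fun_prop)
  symm
  calc ∫⁻ x in unitSlab θ, (∫⁻ s : ℝ, G (x + s • θ)) ∂μ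
      = ∫⁻ x, (∫⁻ s : ℝ, (unitSlab θ).indicator 1 x * G (x + s • θ)) ∂μ := by
        rw [← lintegral_indicator hS]
        refine lintegral_congr fun x => ?_
        by_cases hx : x ∈ unitSlab θ <;> simp [hx]
    _ = ∫⁻ s : ℝ, ∫⁻ x, (unitSlab θ).indicator 1 x * G (x + s • θ) ∂μ :=
        lintegral_lintegral_swap hmeas.aemeasurable
    _ = ∫⁻ s : ℝ, ∫⁻ x, (unitSlab θ).indicator 1 (x - s • θ) * G x ∂μ := by
        refine lintegral_congr fun s => ?_
        rw [← lintegral_add_right_eq_self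
          (fun x => (unitSlab θ).indicator 1 (x - s • θ) * G x) (s • θ)]
        simp only [add_sub_cancel_right]
    _ = ∫⁻ x, (∫⁻ s : ℝ, (unitSlab θ).indicator 1 (x - s • θ) * G x) ∂μ := by
        refine (lintegral_lintegral_swap (Measurable.aemeasurable ?_)).symm
        exact ((measurable_one.indicator hS).comp (by fun_prop)).mul (by fun_prop)
    _ = ∫⁻ x, G x ∂μ := by
        refine lintegral_congr fun x => ?_
        have : ∀ s : ℝ, (unitSlab θ).indicator (1 : E → ℝ≥0∞) (x - s • θ) =
            (Icc (inner ℝ x θ - 1) (inner ℝ x θ)).indicator 1 s := by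
          intro s
          have hiff : x - s • θ ∈ unitSlab θ ↔ s ∈ Icc (inner ℝ x θ - 1) (inner ℝ x θ) := by
            simp only [unitSlab, mem_ofPred_eq, inner_sub_left, inner_smul_left,
              real_inner_self_eq_norm_sq, hθ, mem_Icc]
            simp only [conj_trivial, one_pow, mul_one]
            constructor <;> rintro ⟨h1, h2⟩ <;> constructor <;> linarith
          by_cases h : s ∈ Icc (inner ℝ x θ - 1) (inner ℝ x θ)
          · rw [indicator_of_mem h, indicator_of_mem (hiff.2 h)]; rfl
          · rw [indicator_of_notMem h, indicator_of_notMem (fun h' => h (hiff.1 h'))]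
        simp_rw [this]
        rw [lintegral_mul_const _ (measurable_one.indicator measurableSet_Icc),
          lintegral_indicator_one measurableSet_Icc, Real.volume_Icc]
        simp

end Lines

/-! ### Absolute moments of linear functionals on the sphere -/

section Moments

variable {E : Type*} [NormedAddCommGroup E] [InnerProductSpace ℝ E] [FiniteDimensional ℝ E]
  [MeasurableSpace E] [BorelSpace E]

/-- The `q`-th absolute moment of `⟪v, ·⟫` on the unit sphere. -/
def sphereMoment (q : ℝ) (v : E) : ℝ≥0∞ :=
  ∫⁻ θ : sphere (0 : E) 1, ENNReal.ofReal (|inner ℝ v (θ : E)| ^ q) ∂(volume : Measure E).toSphere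

/-- The Gaussian mass of a slab, after removal of the Gaussian factor in the normal direction. -/
def slabMass (v : E) : ℝ≥0∞ :=
  ∫⁻ x in unitSlab v, ENNReal.ofReal (Real.exp (-(‖x‖ ^ 2 - inner ℝ x v ^ 2)))

theorem integral_abs_rpow_mul_exp {q : ℝ} (hq : 0 ≤ q) :
    ∫⁻ s : ℝ, ENNReal.ofReal (|s| ^ q * Real.exp (-s ^ 2)) =
      ENNReal.ofReal (Real.Gamma ((q + 1) / 2)) := by
  have h1 : ∫ s in Ioi (0 : ℝ), s ^ q * Real.exp (-s ^ (2 : ℝ)) =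
      1 / 2 * Real.Gamma ((q + 1) / 2) :=
    integral_rpow_mul_exp_neg_rpow (by norm_num) (by linarith)
  have hG : 0 < Real.Gamma ((q + 1) / 2) := Real.Gamma_pos_of_pos (by linarith)
  have hi : IntegrableOn (fun s : ℝ => s ^ q * Real.exp (-s ^ (2 : ℝ))) (Ioi 0) := by
    by_contra h
    rw [integral_undef h] at h1
    linarith
  have h2 : ∫ s : ℝ, |s| ^ q * Real.exp (-|s| ^ (2 : ℝ)) = Real.Gamma ((q + 1) / 2) := by
    rw [integral_comp_abs (f := fun s : ℝ => s ^ q * Real.exp (-s ^ (2 : ℝ))), h1]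
    ring
  have hi2 : Integrable fun s : ℝ => |s| ^ q * Real.exp (-|s| ^ (2 : ℝ)) := by
    by_contra h
    rw [integral_undef h] at h2
    exact hG.ne h2
  rw [← h2, ofReal_integral_eq_lintegral_ofReal hi2 (ae_of_all _ fun s => by positivity)]
  refine lintegral_congr fun s => ?_
  rw [Real.rpow_two, sq_abs]

/-- Along a line in direction `v` the Gaussian splits into a factor constant on the line and a
one-dimensional Gaussian in `⟪x, v⟫`. Comparison with the same integral in polar coordinates
determines the moments of the sphere. -/
theorem lintegral_inner_rpow_mul_exp {q : ℝ} (hq : 0 ≤ q) {v : E} (hv : ‖v‖ = 1) :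
    ∫⁻ x : E, ENNReal.ofReal (|inner ℝ v x| ^ q * Real.exp (-‖x‖ ^ 2)) =
      slabMass v * ENNReal.ofReal (Real.Gamma ((q + 1) / 2)) := by
  rw [lintegral_eq_lintegral_unitSlab_lines volume hv (by fun_prop), slabMass,
    ← lintegral_mul_const _ (by fun_prop)]
  refine lintegral_congr fun x => ?_
  rw [← integral_abs_rpow_mul_exp hq, ← lintegral_const_mul _ (by fun_prop),
    ← lintegral_add_left_eq_self
      (fun s : ℝ => ENNReal.ofReal (Real.exp (-(‖x‖ ^ 2 - inner ℝ x v ^ 2))) *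
        ENNReal.ofReal (|s| ^ q * Real.exp (-s ^ 2))) (inner ℝ x v)]
  refine lintegral_congr fun s => ?_
  have h1 : inner ℝ v (x + s • v) = inner ℝ x v + s := by
    rw [inner_add_right, inner_smul_right, real_inner_self_eq_norm_sq, hv, real_inner_comm]
    ring
  have h2 : ‖x + s • v‖ ^ 2 = ‖x‖ ^ 2 + 2 * s * inner ℝ x v + s ^ 2 := by
    rw [norm_add_sq_real, norm_smul, hv, inner_smul_right, Real.norm_eq_abs, mul_one, sq_abs]
    ring
  rw [h1, h2, ← ENNReal.ofReal_mul (by positivity), mul_left_comm, ← Real.exp_add]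
  congr 3
  ring

theorem lintegral_inner_rpow_mul_exp_polar [Nontrivial E] {q : ℝ} (hq : 0 ≤ q) (v : E) :
    ∫⁻ x : E, ENNReal.ofReal (|inner ℝ v x| ^ q * Real.exp (-‖x‖ ^ 2)) =
      sphereMoment q v *
        ENNReal.ofReal (1 / 2 * Real.Gamma ((q + Module.finrank ℝ E) / 2)) := by
  have hd : 0 < Module.finrank ℝ E := Module.finrank_pos
  set d := Module.finrank ℝ E with hdE
  have hd1 : (1 : ℝ) ≤ d := by exact_mod_cast hd
  have h1 : ∫ s in Ioi (0 : ℝ), s ^ (q + d - 1) * Real.exp (-s ^ (2 : ℝ)) =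
      1 / 2 * Real.Gamma ((q + d - 1 + 1) / 2) :=
    integral_rpow_mul_exp_neg_rpow (by norm_num) (by linarith)
  rw [sub_add_cancel] at h1
  have hG : 0 < Real.Gamma ((q + d) / 2) := Real.Gamma_pos_of_pos (by linarith)
  have hi : IntegrableOn (fun s : ℝ => s ^ (q + d - 1) * Real.exp (-s ^ (2 : ℝ))) (Ioi 0) := by
    by_contra h
    rw [integral_undef h] at h1
    linarith
  rw [lintegral_polar volume (by fun_prop), sphereMoment, ← lintegral_mul_const _ (by fun_prop),
    ← h1, ofReal_integral_eq_lintegral_ofReal hi ?_]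
  · refine lintegral_congr fun θ => ?_
    have hθ : ‖(θ : E)‖ = 1 := by simp
    rw [← lintegral_const_mul _ (by fun_prop)]
    refine setLIntegral_congr_fun measurableSet_Ioi fun r hr => ?_
    have hr : 0 < r := hr
    rw [← ENNReal.ofReal_mul (by positivity), ← ENNReal.ofReal_mul (by positivity),
      inner_smul_right, norm_smul, hθ, abs_mul, Real.mul_rpow (abs_nonneg _) (abs_nonneg _),
      Real.norm_eq_abs, abs_of_pos hr, mul_one, Real.rpow_two,
      show q + d - 1 = ((d - 1 : ℕ) : ℝ) + q by push_cast [Nat.cast_sub hd]; ring,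
      Real.rpow_add hr, Real.rpow_natCast]
    congr 1
    ring
  · filter_upwards [ae_restrict_mem measurableSet_Ioi] with r hr
    have hr : 0 < r := hr
    simp only [Pi.zero_apply]
    positivity

/-- The exponent `q = 0` reduces to the total Gaussian mass, which is known. -/
theorem slabMass_eq [Nontrivial E] {v : E} (hv : ‖v‖ = 1) :
    slabMass v = ENNReal.ofReal (Real.pi ^ (((Module.finrank ℝ E : ℝ) - 1) / 2)) := by
  have h1 := lintegral_inner_rpow_mul_exp le_rfl hv
  have h2 := GaussianFourier.integral_rexp_neg_mul_sq_norm (V := E) one_pos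
  have hπ := Real.pi_pos
  have hi : Integrable fun x : E => Real.exp (-1 * ‖x‖ ^ 2) := by
    by_contra h
    rw [integral_undef h] at h2
    have : 0 < (Real.pi / 1) ^ (Module.finrank ℝ E / 2 : ℝ) := by positivity
    linarith
  simp only [Real.rpow_zero, one_mul, zero_add, Real.Gamma_one_half_eq] at h1
  have h3 : ∫⁻ x : E, ENNReal.ofReal (Real.exp (-‖x‖ ^ 2)) =
      ENNReal.ofReal (Real.pi ^ (Module.finrank ℝ E / 2 : ℝ)) := by
    rw [div_one] at h2
    rw [← h2, ofReal_integral_eq_lintegral_ofReal hi (ae_of_all _ fun x => by positivity)]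
    simp
  rw [h3, mul_comm, eq_comm, ← ENNReal.eq_div_iff (by simpa using hπ) ENNReal.ofReal_ne_top,
    ← ENNReal.ofReal_div_of_pos (by positivity)] at h1
  rw [h1, Real.sqrt_eq_rpow, ← Real.rpow_sub hπ]
  congr 2
  ring

theorem sphereMoment_eq [Nontrivial E] {q : ℝ} (hq : 0 ≤ q) {v : E} (hv : ‖v‖ = 1) :
    sphereMoment q v = ENNReal.ofReal (2 * Real.pi ^ (((Module.finrank ℝ E : ℝ) - 1) / 2) *
      Real.Gamma ((q + 1) / 2) / Real.Gamma ((q + Module.finrank ℝ E) / 2)) := by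
  have hd : 0 < Module.finrank ℝ E := Module.finrank_pos
  have hd1 : (0 : ℝ) < Module.finrank ℝ E := by exact_mod_cast hd
  have hG : 0 < Real.Gamma ((q + Module.finrank ℝ E) / 2) := Real.Gamma_pos_of_pos (by linarith)
  have h := lintegral_inner_rpow_mul_exp_polar hq v
  rw [lintegral_inner_rpow_mul_exp hq hv, slabMass_eq hv, ← ENNReal.ofReal_mul (by positivity),
    mul_comm (sphereMoment q v), eq_comm,
    ← ENNReal.eq_div_iff (by simpa using hG) ENNReal.ofReal_ne_top,
    ← ENNReal.ofReal_div_of_pos (by positivity)] at h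
  rw [h]
  congr 1
  field_simp

theorem toSphere_univ_eq [Nontrivial E] : (volume : Measure E).toSphere univ =
    ENNReal.ofReal (2 * Real.pi ^ (((Module.finrank ℝ E : ℝ) - 1) / 2) *
      Real.sqrt Real.pi / Real.Gamma (Module.finrank ℝ E / 2)) := by
  obtain ⟨v, hv⟩ := exists_norm_eq E zero_le_one
  have h := sphereMoment_eq le_rfl hv
  rw [zero_add, zero_add, Real.Gamma_one_half_eq] at h
  rw [← h]
  simp [sphereMoment]

end Moments

/-! ### Directional maximal truncated Hilbert transforms -/

section Directional

variable {E : Type*} [NormedAddCommGroup E] [InnerProductSpace ℝ E]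

/-- The truncated Hilbert transform in direction `θ`. -/
def lineHilbert (t : ℝ) (f : E → ℂ) (θ x : E) : ℂ :=
  ∫ r in Ioi t, (r⁻¹ : ℝ) • (f (x - r • θ) - f (x + r • θ))

/-- The maximal truncated Hilbert transform in direction `θ`, over rational truncations. -/
def dirMax (f : E → ℂ) (θ x : E) : ℝ≥0∞ :=
  ⨆ t : {t : ℚ // 0 < t}, ‖lineHilbert ((t : ℚ) : ℝ) f θ x‖ₑ

theorem lineHilbert_add_smul (t : ℝ) (f : E → ℂ) (θ x : E) (s : ℝ) :
    lineHilbert t f θ (x + s • θ) = truncH t (fun u => f (x + u • θ)) s := by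
  unfold lineHilbert truncH
  simp only [sub_smul, add_smul, add_sub_assoc, add_assoc]

theorem dirMax_add_smul_le (f : E → ℂ) (θ x : E) (s : ℝ) :
    dirMax f θ (x + s • θ) ≤ hilbertMax (fun u => f (x + u • θ)) s := by
  refine iSup_le fun t => ?_
  rw [lineHilbert_add_smul]
  have ht : (0 : ℝ) < ((t : ℚ) : ℝ) := Rat.cast_pos.2 t.2
  exact le_iSup (fun t : Ioi (0 : ℝ) => ‖truncH t (fun u => f (x + u • θ)) s‖ₑ) ⟨_, ht⟩

variable [FiniteDimensional ℝ E] [MeasurableSpace E] [BorelSpace E]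

theorem measurable_lineHilbert (t : ℝ) {f : E → ℂ} (hf : Measurable f) :
    Measurable fun q : E × E => lineHilbert t f q.1 q.2 := by
  have hm : StronglyMeasurable fun q : (E × E) × ℝ =>
      (q.2⁻¹ : ℝ) • (f (q.1.2 - q.2 • q.1.1) - f (q.1.2 + q.2 • q.1.1)) :=
    Measurable.stronglyMeasurable (by fun_prop)
  exact (StronglyMeasurable.integral_prod_right' (ν := volume.restrict (Ioi t)) hm).measurable

theorem measurable_dirMax {f : E → ℂ} (hf : Measurable f) :
    Measurable fun q : E × E => dirMax f q.1 q.2 :=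
  Measurable.iSup fun t => (measurable_lineHilbert ((t : ℚ) : ℝ) hf).enorm

/-- The one-dimensional bound is integrated over all lines parallel to `θ`, so its constant passes
unchanged to every dimension. -/
theorem lintegral_dirMax_rpow_le {p : ℝ} (hp : 1 < p) {K : NNReal}
    (hK : ∀ g : ℝ → ℂ, Measurable g →
      ∫⁻ x : ℝ, hilbertMax g x ^ p ≤ K * ∫⁻ x, ‖g x‖ₑ ^ p)
    {f : E → ℂ} (hf : Measurable f) {θ : E} (hθ : ‖θ‖ = 1) :
    ∫⁻ x : E, dirMax f θ x ^ p ≤ K * ∫⁻ x : E, ‖f x‖ₑ ^ p := by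
  have hp0 : 0 < p := by linarith
  have hm : Measurable (dirMax f θ) := (measurable_dirMax hf).of_uncurry_left (f := dirMax f)
  have hmf : Measurable fun x => ‖f x‖ₑ ^ p := by fun_prop
  calc ∫⁻ x : E, dirMax f θ x ^ p
      = ∫⁻ x in unitSlab θ, ∫⁻ s : ℝ, dirMax f θ (x + s • θ) ^ p :=
        lintegral_eq_lintegral_unitSlab_lines volume hθ (hm.pow_const p)
    _ ≤ ∫⁻ x in unitSlab θ, K * ∫⁻ s : ℝ, ‖f (x + s • θ)‖ₑ ^ p := by
        refine lintegral_mono fun x => ?_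
        refine le_trans ?_ (hK (fun u => f (x + u • θ)) (by fun_prop))
        exact lintegral_mono fun s => ENNReal.rpow_le_rpow (dirMax_add_smul_le f θ x s) hp0.le
    _ = K * ∫⁻ x in unitSlab θ, ∫⁻ s : ℝ, ‖f (x + s • θ)‖ₑ ^ p :=
        lintegral_const_mul' _ _ ENNReal.coe_ne_top
    _ = K * ∫⁻ x : E, ‖f x‖ₑ ^ p := by
        rw [lintegral_eq_lintegral_unitSlab_lines volume hθ hmf]

end Directional

/-! ### Truncated Riesz transforms as averages of directional Hilbert transforms -/

section Riesz

variable {d : ℕ}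

local notation "𝔼" => EuclideanSpace ℝ (Fin d)

/-- The kernel of the Riesz transform in direction `v`. -/
def rieszK (v y : EuclideanSpace ℝ (Fin d)) : ℝ := inner ℝ v y / ‖y‖ ^ (d + 1)

/-- The normalising constant of the Riesz transforms. -/
def rieszC (d : ℕ) : ℝ := Real.Gamma (((d : ℝ) + 1) / 2) / Real.pi ^ (((d : ℝ) + 1) / 2)

/-- The truncated Riesz transform in direction `v`, without the normalising constant. -/
def rieszT (v : EuclideanSpace ℝ (Fin d)) (t : ℝ) (f : EuclideanSpace ℝ (Fin d) → ℂ)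
    (x : EuclideanSpace ℝ (Fin d)) : ℂ :=
  ∫ y in {y | t < ‖y‖}, rieszK v y • f (x - y)

theorem rieszC_pos (d : ℕ) : 0 < rieszC d := by
  have := Real.Gamma_pos_of_pos (by positivity : 0 < ((d : ℝ) + 1) / 2)
  have := Real.pi_pos
  unfold rieszC
  positivity

theorem measurableSet_lt_norm (t : ℝ) : MeasurableSet {y : 𝔼 | t < ‖y‖} :=
  measurableSet_lt measurable_const measurable_norm

@[fun_prop] theorem measurable_rieszK (v : 𝔼) : Measurable (rieszK v) := by
  unfold rieszK; fun_prop

theorem rieszK_neg (v y : 𝔼) : rieszK v (-y) = -rieszK v y := by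
  unfold rieszK; rw [inner_neg_right, norm_neg, neg_div]

theorem abs_rieszK_le (v y : 𝔼) : |rieszK v y| ≤ ‖v‖ * (‖y‖ ^ d)⁻¹ := by
  unfold rieszK
  rcases eq_or_ne y 0 with rfl | hy
  · simp only [inner_zero_right, zero_div, abs_zero]; positivity
  · have hy0 : 0 < ‖y‖ := norm_pos_iff.2 hy
    rw [abs_div, abs_of_pos (by positivity : 0 < ‖y‖ ^ (d + 1)), div_le_iff₀ (by positivity)]
    refine (abs_real_inner_le_norm v y).trans (le_of_eq ?_)
    rw [pow_succ]
    field_simp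

theorem rieszK_single (j : Fin d) (y : 𝔼) :
    rieszK (EuclideanSpace.single j 1) y = y j / ‖y‖ ^ (d + 1) := by
  simp [rieszK, EuclideanSpace.inner_single_left]

theorem integrableOn_rieszK {p t : ℝ} (hp : 1 < p) (ht : 0 < t) (hd : 0 < d) {f : 𝔼 → ℂ}
    (hf : MemLp f (ENNReal.ofReal p) volume) (v x : 𝔼) :
    IntegrableOn (fun y => rieszK v y • f (x - y)) {y | t < ‖y‖} := by
  have h1 := integrableOn_norm_pow_inv_mul (μ := (volume : Measure 𝔼)) hp ht (by simpa using hd) hf x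
  rw [finrank_euclideanSpace_fin] at h1
  have hfm : AEStronglyMeasurable (fun y => f (x - y)) volume :=
    hf.1.comp_measurePreserving (Measure.measurePreserving_sub_left volume x)
  refine (h1.norm.const_mul ‖v‖).mono' ?_ (ae_of_all _ fun y => ?_)
  · exact ((measurable_rieszK v).aestronglyMeasurable.smul hfm).restrict
  · rw [norm_smul, norm_smul, ← mul_assoc, Real.norm_eq_abs, norm_inv, norm_pow, norm_norm]
    gcongr
    exact abs_rieszK_le v y

theorem rieszIntegrand_eq (j : Fin d) (f : 𝔼 → ℂ) (x y : 𝔼) :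
    rieszIntegrand j f x y = rieszK (EuclideanSpace.single j 1) (x - y) • f (x - (x - y)) := by
  rw [rieszK_single, rieszIntegrand, sub_sub_cancel, Complex.real_smul]
  rfl

theorem integrableOn_rieszIntegrand {p t : ℝ} (hp : 1 < p) (ht : 0 < t) (hd : 0 < d) {f : 𝔼 → ℂ}
    (hf : MemLp f (ENNReal.ofReal p) volume) (j : Fin d) (x : 𝔼) :
    IntegrableOn (rieszIntegrand j f x) {y | t < ‖x - y‖} := by
  have h := integrableOn_rieszK hp ht hd hf (EuclideanSpace.single j 1) x
  rw [← integrable_indicator_iff (measurableSet_lt_norm t)] at h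
  rw [← integrable_indicator_iff (measurableSet_lt measurable_const (by fun_prop))]
  refine (h.comp_sub_left x).congr (ae_of_all _ fun y => ?_)
  simp only [indicator, mem_ofPred_eq, rieszIntegrand_eq]

theorem truncRiesz_eq (j : Fin d) (t : ℝ) (f : 𝔼 → ℂ) (x : 𝔼) :
    truncRiesz j t f x = (rieszC d : ℂ) * rieszT (EuclideanSpace.single j 1) t f x := by
  unfold truncRiesz rieszT
  rw [← integral_indicator (measurableSet_lt_norm t),
    ← integral_sub_left_eq_self _ volume x,
    ← integral_indicator (measurableSet_lt measurable_const (by fun_prop))]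
  unfold rieszC
  congr 2
  funext y
  simp only [indicator, mem_ofPred_eq, rieszIntegrand_eq]

theorem rieszT_sum {p t : ℝ} (hp : 1 < p) (ht : 0 < t) (hd : 0 < d) {f : 𝔼 → ℂ}
    (hf : MemLp f (ENNReal.ofReal p) volume) (v x : 𝔼) :
    ∑ j, (v j : ℝ) • rieszT (EuclideanSpace.single j 1) t f x = rieszT v t f x := by
  unfold rieszT
  simp_rw [← integral_smul]
  have hi : ∀ j ∈ Finset.univ, IntegrableOn
      (fun y => (v j : ℝ) • rieszK (EuclideanSpace.single j 1) y • f (x - y)) {y | t < ‖y‖} :=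
    fun j _ => (integrableOn_rieszK hp ht hd hf _ x).smul (v j)
  rw [← integral_finsetSum _ hi]
  refine integral_congr_ae (ae_of_all _ fun y => ?_)
  simp only [← smul_assoc, ← Finset.sum_smul, smul_eq_mul]
  congr 1
  simp only [rieszK_single]
  rw [rieszK, PiLp.inner_apply, Finset.sum_div]
  refine Finset.sum_congr rfl fun j _ => ?_
  simp only [RCLike.inner_apply, conj_trivial]
  ring

theorem integrableOn_rieszK_add {p t : ℝ} (hp : 1 < p) (ht : 0 < t) (hd : 0 < d) {f : 𝔼 → ℂ}
    (hf : MemLp f (ENNReal.ofReal p) volume) (v x : 𝔼) :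
    IntegrableOn (fun y => rieszK v y • f (x + y)) {y | t < ‖y‖} := by
  have h := integrableOn_rieszK hp ht hd
    (hf.comp_measurePreserving (Measure.measurePreserving_neg volume)) v (-x)
  refine h.congr_fun (fun y _ => ?_) (measurableSet_lt_norm t)
  simp [add_comm]

/-- Oddness of the kernel under `y ↦ -y` produces the symmetric differences that define the Hilbert
transform on a line. -/
theorem rieszT_symm {p t : ℝ} (hp : 1 < p) (ht : 0 < t) (hd : 0 < d) {f : 𝔼 → ℂ}
    (hf : MemLp f (ENNReal.ofReal p) volume) (v x : 𝔼) :
    2 * rieszT v t f x =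
      ∫ y in {y | t < ‖y‖}, rieszK v y • (f (x - y) - f (x + y)) := by
  have h1 : rieszT v t f x = -∫ y in {y | t < ‖y‖}, rieszK v y • f (x + y) := by
    unfold rieszT
    rw [← integral_neg, ← integral_indicator (measurableSet_lt_norm t),
      ← integral_neg_eq_self, ← integral_indicator (measurableSet_lt_norm t)]
    congr 1
    funext y
    simp only [indicator, mem_ofPred_eq, norm_neg, rieszK_neg, sub_neg_eq_add, neg_smul]
  simp_rw [smul_sub]
  rw [integral_sub (integrableOn_rieszK hp ht hd hf v x)
    (integrableOn_rieszK_add hp ht hd hf v x), two_mul]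
  nth_rewrite 2 [h1]
  rfl

theorem rieszT_eq_average {p t : ℝ} (hp : 1 < p) (ht : 0 < t) (hd : 0 < d) {f : 𝔼 → ℂ}
    (hf : MemLp f (ENNReal.ofReal p) volume) (v x : 𝔼) :
    2 * rieszT v t f x = ∫ θ : sphere (0 : 𝔼) 1, (inner ℝ v (θ : 𝔼) : ℝ) • lineHilbert t f θ x
      ∂(volume : Measure 𝔼).toSphere := by
  have : Nonempty (Fin d) := ⟨⟨0, hd⟩⟩
  have hint : IntegrableOn (fun y => rieszK v y • (f (x - y) - f (x + y))) {y | t < ‖y‖} := by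
    simp_rw [smul_sub]
    exact (integrableOn_rieszK hp ht hd hf v x).sub (integrableOn_rieszK_add hp ht hd hf v x)
  rw [rieszT_symm hp ht hd hf, ← integral_indicator (measurableSet_lt_norm t),
    integral_polar volume ((integrable_indicator_iff (measurableSet_lt_norm t)).2 hint)]
  refine integral_congr_ae (ae_of_all _ fun θ => ?_)
  have hθ : ‖(θ : 𝔼)‖ = 1 := by simp
  have hsub : Ioi t ⊆ Ioi (0 : ℝ) := Ioi_subset_Ioi ht.le
  simp only [lineHilbert]
  rw [← integral_smul, ← inter_eq_self_of_subset_right hsub, ← setIntegral_indicator measurableSet_Ioi,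
    finrank_euclideanSpace_fin]
  refine setIntegral_congr_fun measurableSet_Ioi fun r hr => ?_
  have hr : 0 < r := hr
  have hnorm : ‖r • (θ : 𝔼)‖ = r := by rw [norm_smul, hθ, Real.norm_of_nonneg hr.le, mul_one]
  by_cases h : t < r
  · rw [indicator_of_mem (mem_Ioi.2 h), indicator_of_mem
      (by simpa only [mem_ofPred_eq, hnorm] using h : r • (θ : 𝔼) ∈ {y : 𝔼 | t < ‖y‖}),
      smul_smul, smul_smul]
    congr 1
    rw [rieszK, hnorm, inner_smul_right]
    -- The Jacobian `r ^ (d - 1)` times `r / r ^ (d + 1)` leaves `r⁻¹`; writing `d = m + 1` removes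
    -- natural subtraction.
    obtain ⟨m, rfl⟩ : ∃ m, d = m + 1 := ⟨d - 1, by omega⟩
    rw [Nat.add_sub_cancel]
    field_simp
    ring
  · rw [indicator_of_notMem (fun h' => h (mem_Ioi.1 h')), indicator_of_notMem
      (by simpa only [mem_ofPred_eq, hnorm] using h : r • (θ : 𝔼) ∉ {y : 𝔼 | t < ‖y‖}),
      smul_zero]

theorem enorm_rieszT_le {p q t : ℝ} (hpq : p.HolderConjugate q) (ht : 0 < t) (hd : 0 < d)
    {f : 𝔼 → ℂ} (hfm : Measurable f) (hf : MemLp f (ENNReal.ofReal p) volume) (v x : 𝔼) :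
    2 * ‖rieszT v t f x‖ₑ ≤ sphereMoment q v ^ (1 / q) *
      (∫⁻ θ : sphere (0 : 𝔼) 1, ‖lineHilbert t f θ x‖ₑ ^ p ∂(volume : Measure 𝔼).toSphere)
        ^ (1 / p) := by
  have hm : Measurable fun θ : sphere (0 : 𝔼) 1 => ‖lineHilbert t f θ x‖ₑ :=
    ((measurable_lineHilbert t hfm).comp (measurable_subtype_coe.prodMk measurable_const)).enorm
  have hmi : Measurable fun θ : sphere (0 : 𝔼) 1 => ‖(inner ℝ v (θ : 𝔼) : ℝ)‖ₑ := by fun_prop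
  calc 2 * ‖rieszT v t f x‖ₑ = ‖2 * rieszT v t f x‖ₑ := by
        rw [enorm_mul, ← ofReal_norm (2 : ℂ), Complex.norm_ofNat, ENNReal.ofReal_ofNat]
    _ ≤ ∫⁻ θ : sphere (0 : 𝔼) 1, ‖(inner ℝ v (θ : 𝔼) : ℝ)‖ₑ * ‖lineHilbert t f θ x‖ₑ
          ∂(volume : Measure 𝔼).toSphere := by
        rw [rieszT_eq_average hpq.lt ht hd hf]
        refine (enorm_integral_le_lintegral_enorm _).trans (le_of_eq ?_)
        simp_rw [enorm_smul]
    _ ≤ _ := by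
        refine (ENNReal.lintegral_mul_le_Lp_mul_Lq _ hpq.symm hmi.aemeasurable
          hm.aemeasurable).trans (le_of_eq ?_)
        congr 2
        refine lintegral_congr fun θ => ?_
        rw [← ofReal_norm, ENNReal.ofReal_rpow_of_nonneg (norm_nonneg _) hpq.symm.nonneg]
        rfl

/-- The euclidean norm of a complex vector is controlled by its real linear combinations. -/
theorem sqrt_sum_norm_sq_le (w : Fin d → ℂ) {B : ℝ} (hB : 0 ≤ B)
    (h : ∀ v : 𝔼, ‖v‖ = 1 → ‖∑ j, (v j : ℝ) • w j‖ ≤ B) :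
    Real.sqrt (∑ j, ‖w j‖ ^ 2) ≤ 2 * B := by
  have key : ∀ L : ℂ →ₗ[ℝ] ℝ, (∀ z, |L z| ≤ ‖z‖) →
      ‖(WithLp.toLp 2 fun j => L (w j) : 𝔼)‖ ≤ B := by
    intro L hL
    set a : 𝔼 := WithLp.toLp 2 fun j => L (w j) with ha
    rcases eq_or_ne a 0 with h0 | h0
    · rw [h0, norm_zero]; exact hB
    · have ha0 : ‖a‖ ≠ 0 := norm_ne_zero_iff.2 h0
      -- The vector of real (or imaginary) parts is tested against its own direction.
      have h1 := h (‖a‖⁻¹ • a) (by rw [norm_smul, norm_inv, norm_norm, inv_mul_cancel₀ ha0])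
      refine le_trans ?_ ((hL _).trans h1)
      rw [map_sum]
      simp only [map_smul, smul_eq_mul, PiLp.smul_apply]
      have h2 : ∑ j, ‖a‖⁻¹ * a j * L (w j) = ‖a‖ := by
        have h3 : ∑ j, a j * L (w j) = ‖a‖ ^ 2 := by
          rw [EuclideanSpace.real_norm_sq_eq]
          refine Finset.sum_congr rfl fun j _ => ?_
          rw [sq]
        simp_rw [mul_assoc]
        rw [← Finset.mul_sum, h3]
        field_simp
      rw [h2]
      exact le_abs_self _
  have hre := key Complex.reLm Complex.abs_re_le_norm
  have him := key Complex.imLm Complex.abs_im_le_norm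
  have hsum : ∑ j, ‖w j‖ ^ 2 =
      ‖(WithLp.toLp 2 fun j => Complex.reLm (w j) : 𝔼)‖ ^ 2 +
        ‖(WithLp.toLp 2 fun j => Complex.imLm (w j) : 𝔼)‖ ^ 2 := by
    rw [EuclideanSpace.real_norm_sq_eq, EuclideanSpace.real_norm_sq_eq, ← Finset.sum_add_distrib]
    refine Finset.sum_congr rfl fun j _ => ?_
    rw [Complex.sq_norm, Complex.normSq_apply]
    simp [sq]
  rw [hsum]
  -- Real and imaginary parts give at most `2 * B ^ 2`. The cruder factor 2 is offset later by the 2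
  -- in `rieszT_eq_average`.
  refine Real.sqrt_le_iff.2 ⟨by positivity, ?_⟩
  nlinarith [norm_nonneg (WithLp.toLp 2 fun j => Complex.reLm (w j) : 𝔼),
    norm_nonneg (WithLp.toLp 2 fun j => Complex.imLm (w j) : 𝔼)]

end Riesz

section Maximal

variable {d : ℕ}

local notation "𝔼" => EuclideanSpace ℝ (Fin d)

/-! ### The dimension-free constant -/

/-- The constant obtained from the moments of the sphere. -/
def sphereConst (p q : ℝ) : ℝ :=
  2 / Real.pi * Real.Gamma ((q + 1) / 2) ^ (1 / q) * Real.sqrt Real.pi ^ (1 / p)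

theorem sphereConst_pos {p q : ℝ} (hq : 0 < q) : 0 < sphereConst p q := by
  have := Real.Gamma_pos_of_pos (by linarith : 0 < (q + 1) / 2)
  have := Real.pi_pos
  unfold sphereConst
  positivity

theorem rieszC_mul_le (hd : 0 < d) {p q : ℝ} (hpq : p.HolderConjugate q) :
    rieszC d * ((2 * Real.pi ^ (((d : ℝ) - 1) / 2) * Real.Gamma ((q + 1) / 2) /
        Real.Gamma ((q + d) / 2)) ^ (1 / q) *
      (2 * Real.pi ^ (((d : ℝ) - 1) / 2) * Real.sqrt Real.pi / Real.Gamma (d / 2)) ^ (1 / p)) ≤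
    sphereConst p q := by
  have hπ := Real.pi_pos
  have hd0 : (0 : ℝ) < d := by exact_mod_cast hd
  have hp := hpq.pos
  have hq := hpq.symm.pos
  have hsum : 1 / q + 1 / p = 1 := by simpa using hpq.symm.inv_add_inv_eq_one
  have hg := Real.Gamma_pos_of_pos (by linarith : 0 < (q + 1) / 2)
  have hG1 := Real.Gamma_pos_of_pos (by linarith : 0 < (q + d) / 2)
  have hG2 := Real.Gamma_pos_of_pos (by linarith : 0 < (d : ℝ) / 2)
  have hconv := Real.Gamma_mul_add_mul_le_rpow_Gamma_mul_rpow_Gamma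
    (by linarith : 0 < (q + d) / 2) (by linarith : 0 < (d : ℝ) / 2)
    (by positivity : 0 < 1 / q) (by positivity : 0 < 1 / p) hsum
  -- With weights `1 / q` and `1 / p`, the mean of the two Gamma arguments is exactly the argument
  -- in `rieszC d`; log-convexity therefore cancels all Gamma factors depending on `d`.
  rw [show 1 / q * ((q + d) / 2) + 1 / p * (d / 2) = ((d : ℝ) + 1) / 2 by
    have : 1 / q * ((q + d) / 2) + 1 / p * (d / 2) = 1 / q * q / 2 + (1 / q + 1 / p) * d / 2 := by
      ring
    rw [this, hsum, one_div_mul_cancel hq.ne']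
    ring] at hconv
  set A := 2 * Real.pi ^ (((d : ℝ) - 1) / 2) with hA
  have hA0 : 0 < A := by positivity
  have hAsplit : A ^ (1 / q) * A ^ (1 / p) = A := by
    rw [← Real.rpow_add hA0, hsum, Real.rpow_one]
  have hAπ : A / Real.pi ^ (((d : ℝ) + 1) / 2) = 2 / Real.pi := by
    rw [hA, mul_div_assoc, ← Real.rpow_sub hπ,
      show ((d : ℝ) - 1) / 2 - ((d : ℝ) + 1) / 2 = -1 by ring, Real.rpow_neg_one]
    rfl
  rw [Real.div_rpow (by positivity) hG1.le, Real.div_rpow (by positivity) hG2.le,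
    Real.mul_rpow hA0.le hg.le, Real.mul_rpow hA0.le (by positivity)]
  set G := Real.Gamma ((q + d) / 2) ^ (1 / q) * Real.Gamma (d / 2) ^ (1 / p) with hG
  have hGpos : 0 < G := by positivity
  calc rieszC d * (A ^ (1 / q) * Real.Gamma ((q + 1) / 2) ^ (1 / q) /
        Real.Gamma ((q + d) / 2) ^ (1 / q) *
        (A ^ (1 / p) * Real.sqrt Real.pi ^ (1 / p) / Real.Gamma (d / 2) ^ (1 / p)))
      = Real.Gamma (((d : ℝ) + 1) / 2) / G * ((A ^ (1 / q) * A ^ (1 / p)) /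
          Real.pi ^ (((d : ℝ) + 1) / 2) * Real.Gamma ((q + 1) / 2) ^ (1 / q) *
          Real.sqrt Real.pi ^ (1 / p)) := by
        rw [rieszC, hG]
        field_simp
    _ = Real.Gamma (((d : ℝ) + 1) / 2) / G * sphereConst p q := by
        rw [hAsplit, hAπ, sphereConst]
    _ ≤ 1 * sphereConst p q := by
        have := sphereConst_pos (p := p) hq
        gcongr
        exact (div_le_one hGpos).2 hconv
    _ = _ := one_mul _

theorem ofReal_rieszC_mul_le (hd : 0 < d) {p q : ℝ} (hpq : p.HolderConjugate q) {v : 𝔼}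
    (hv : ‖v‖ = 1) :
    ENNReal.ofReal (rieszC d) * (sphereMoment q v ^ (1 / q) *
      (volume : Measure 𝔼).toSphere univ ^ (1 / p)) ≤ ENNReal.ofReal (sphereConst p q) := by
  have : Nonempty (Fin d) := ⟨⟨0, hd⟩⟩
  have hπ := Real.pi_pos
  have hd0 : (0 : ℝ) < d := by exact_mod_cast hd
  have hp := hpq.pos
  have hq := hpq.symm.pos
  have hg := Real.Gamma_pos_of_pos (by linarith : 0 < (q + 1) / 2)
  have hG1 := Real.Gamma_pos_of_pos (by linarith : 0 < (q + d) / 2)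
  have hG2 := Real.Gamma_pos_of_pos (by linarith : 0 < (d : ℝ) / 2)
  rw [sphereMoment_eq hq.le hv, toSphere_univ_eq, finrank_euclideanSpace_fin,
    ENNReal.ofReal_rpow_of_nonneg (by positivity) (by positivity),
    ENNReal.ofReal_rpow_of_nonneg (by positivity) (by positivity),
    ← ENNReal.ofReal_mul (by positivity), ← ENNReal.ofReal_mul (rieszC_pos d).le]
  exact ENNReal.ofReal_le_ofReal (rieszC_mul_le hd hpq)

/-! ### The maximal function -/

theorem truncRiesz_congr {f g : 𝔼 → ℂ} (h : f =ᵐ[volume] g) (j : Fin d) (t : ℝ) (x : 𝔼) :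
    truncRiesz j t f x = truncRiesz j t g x := by
  unfold truncRiesz
  congr 1
  refine integral_congr_ae (ae_restrict_of_ae ?_)
  filter_upwards [h] with y hy
  rw [rieszIntegrand, rieszIntegrand, hy]

theorem maxTruncRiesz_congr {f g : 𝔼 → ℂ} (h : f =ᵐ[volume] g) :
    maxTruncRiesz f = maxTruncRiesz g := by
  funext x
  simp only [maxTruncRiesz, truncRiesz_congr h]

theorem measurable_truncRiesz (j : Fin d) (t : ℝ) {f : 𝔼 → ℂ} (hf : Measurable f) :
    Measurable (truncRiesz j t f) := by
  have h : truncRiesz j t f =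
      fun x => (rieszC d : ℂ) * rieszT (EuclideanSpace.single j 1) t f x :=
    funext fun x => truncRiesz_eq j t f x
  have hm : StronglyMeasurable fun q : 𝔼 × 𝔼 =>
      rieszK (EuclideanSpace.single j 1) q.2 • f (q.1 - q.2) :=
    Measurable.stronglyMeasurable (by fun_prop)
  have hm2 := (hm.integral_prod_right' (ν := volume.restrict {y : 𝔼 | t < ‖y‖})).measurable
  rw [h]
  exact hm2.const_mul _

/-- The euclidean norm of the vector of truncated Riesz transforms. -/
def vecRiesz (f : EuclideanSpace ℝ (Fin d) → ℂ) (x : EuclideanSpace ℝ (Fin d)) (t : ℝ) : ℝ≥0∞ :=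
  ENNReal.ofReal (Real.sqrt (∑ j : Fin d, ‖truncRiesz j t f x‖ ^ 2))

/-- Right-continuity in the truncation: as the radii decrease to `t`, the domains increase to the
full one because the inequality is strict. -/
theorem tendsto_truncRiesz {p t : ℝ} (hp : 1 < p) (ht : 0 < t) (hd : 0 < d) {f : 𝔼 → ℂ}
    (hf : MemLp f (ENNReal.ofReal p) volume) (j : Fin d) (x : 𝔼) {u : ℕ → ℝ} (hu : StrictAnti u)
    (hut : ∀ n, t < u n) (hlim : Tendsto u atTop (𝓝 t)) :
    Tendsto (fun n => truncRiesz j (u n) f x) atTop (𝓝 (truncRiesz j t f x)) := by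
  refine Tendsto.const_mul _ ?_
  have hset : ⋃ n, {y : 𝔼 | u n < ‖x - y‖} = {y : 𝔼 | t < ‖x - y‖} := by
    ext y
    simp only [mem_iUnion, mem_ofPred_eq]
    refine ⟨fun ⟨n, hn⟩ => (hut n).trans hn, fun h => ?_⟩
    exact (hlim.eventually (gt_mem_nhds h)).exists
  have := tendsto_setIntegral_of_monotone (μ := volume) (f := rieszIntegrand j f x)
    (s := fun n => {y : 𝔼 | u n < ‖x - y‖})
    (fun n => measurableSet_lt measurable_const (by fun_prop))
    (fun m n hmn y (hy : u m < ‖x - y‖) => lt_of_le_of_lt (hu.antitone hmn) hy)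
    (by rw [hset]; exact integrableOn_rieszIntegrand hp ht hd hf j x)
  rwa [hset] at this

/-- By right-continuity rational truncations suffice. This gives measurability and matches the
rational supremum in `dirMax`. -/
theorem maxTruncRiesz_eq_iSup_rat {p : ℝ} (hp : 1 < p) (hd : 0 < d) {f : 𝔼 → ℂ}
    (hf : MemLp f (ENNReal.ofReal p) volume) (x : 𝔼) :
    maxTruncRiesz f x = ⨆ t : {t : ℚ // 0 < t}, vecRiesz f x ((t : ℚ) : ℝ) := by
  refine le_antisymm (iSup₂_le fun t ht => ?_) (iSup_le fun t => ?_)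
  · obtain ⟨u, hu, hut, hlim⟩ := Real.exists_seq_rat_strictAnti_tendsto t
    have hu' : StrictAnti fun n => ((u n : ℚ) : ℝ) := fun m n hmn => Rat.cast_lt.2 (hu hmn)
    have h1 : Tendsto (fun n => vecRiesz f x (u n)) atTop (𝓝 (vecRiesz f x t)) := by
      refine ENNReal.tendsto_ofReal ((Real.continuous_sqrt.tendsto _).comp ?_)
      refine tendsto_finsetSum _ fun j _ => ?_
      exact (tendsto_truncRiesz hp ht hd hf j x hu' hut hlim).norm.pow 2
    refine le_of_tendsto' h1 fun n => ?_
    have hn : 0 < u n := Rat.cast_pos.1 (ht.trans (hut n))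
    exact le_iSup (fun t : {t : ℚ // 0 < t} => vecRiesz f x ((t : ℚ) : ℝ)) ⟨u n, hn⟩
  · have ht : (0 : ℝ) < ((t : ℚ) : ℝ) := Rat.cast_pos.2 t.2
    exact le_iSup₂ (f := fun (t : ℝ) (_ : 0 < t) => vecRiesz f x t) _ ht

theorem measurable_maxTruncRiesz {p : ℝ} (hp : 1 < p) (hd : 0 < d) {f : 𝔼 → ℂ}
    (hfm : Measurable f) (hf : MemLp f (ENNReal.ofReal p) volume) :
    Measurable (maxTruncRiesz f) := by
  have h : maxTruncRiesz f = fun x => ⨆ t : {t : ℚ // 0 < t}, vecRiesz f x ((t : ℚ) : ℝ) :=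
    funext fun x => maxTruncRiesz_eq_iSup_rat hp hd hf x
  rw [h]
  refine Measurable.iSup fun t => ?_
  unfold vecRiesz
  have := fun j => measurable_truncRiesz (d := d) j ((t : ℚ) : ℝ) hfm
  fun_prop

theorem maxTruncRiesz_le {p q : ℝ} (hpq : p.HolderConjugate q) (hd : 0 < d) {f : 𝔼 → ℂ}
    (hfm : Measurable f) (hf : MemLp f (ENNReal.ofReal p) volume) {v : 𝔼} (hv : ‖v‖ = 1) (x : 𝔼) :
    maxTruncRiesz f x ≤ ENNReal.ofReal (rieszC d) * (sphereMoment q v ^ (1 / q) *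
      (∫⁻ θ : sphere (0 : 𝔼) 1, dirMax f θ x ^ p ∂(volume : Measure 𝔼).toSphere) ^ (1 / p)) := by
  have : Nonempty (Fin d) := ⟨⟨0, hd⟩⟩
  have hp := hpq.pos
  rw [maxTruncRiesz_eq_iSup_rat hpq.lt hd hf]
  refine iSup_le fun t => ?_
  have ht : (0 : ℝ) < ((t : ℚ) : ℝ) := Rat.cast_pos.2 t.2
  set B := ENNReal.ofReal (rieszC d) * (sphereMoment q v ^ (1 / q) *
      (∫⁻ θ : sphere (0 : 𝔼) 1, dirMax f θ x ^ p ∂(volume : Measure 𝔼).toSphere) ^ (1 / p))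
    with hB
  rcases eq_or_ne B ⊤ with htop | htop
  · rw [htop]; exact le_top
  have key : ∀ w : 𝔼, ‖w‖ = 1 →
      ‖∑ j, (w j : ℝ) • truncRiesz j ((t : ℚ) : ℝ) f x‖ ≤ B.toReal / 2 := by
    intro w hw
    have hsum : ∑ j, (w j : ℝ) • truncRiesz j ((t : ℚ) : ℝ) f x =
        (rieszC d : ℂ) * rieszT w ((t : ℚ) : ℝ) f x := by
      rw [← rieszT_sum hpq.lt ht hd hf w x, Finset.mul_sum]
      refine Finset.sum_congr rfl fun j _ => ?_
      rw [truncRiesz_eq, mul_smul_comm]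
    -- The direction `w` varies with the vector being tested, but its moment does not; the bound
    -- keeps one fixed `v`.
    have hmom : sphereMoment q w = sphereMoment q v := by
      rw [sphereMoment_eq hpq.symm.nonneg hw, sphereMoment_eq hpq.symm.nonneg hv]
    have h1 : 2 * ‖(rieszC d : ℂ) * rieszT w ((t : ℚ) : ℝ) f x‖ₑ ≤ B := by
      rw [enorm_mul, mul_left_comm, ← ofReal_norm, Complex.norm_real,
        Real.norm_of_nonneg (rieszC_pos d).le, hB]
      refine mul_le_mul_right ?_ _
      refine (enorm_rieszT_le hpq ht hd hfm hf w x).trans ?_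
      rw [hmom]
      gcongr with θ
      exact le_iSup (fun t : {t : ℚ // 0 < t} => ‖lineHilbert ((t : ℚ) : ℝ) f θ x‖ₑ) t
    rw [hsum, le_div_iff₀ two_pos, mul_comm]
    refine (ENNReal.ofReal_le_iff_le_toReal htop).1 (le_trans (le_of_eq ?_) h1)
    rw [ENNReal.ofReal_mul zero_le_two, ofReal_norm, ENNReal.ofReal_ofNat]
  have h2 := sqrt_sum_norm_sq_le _ (by positivity) key
  rw [mul_div_cancel₀ _ two_ne_zero] at h2
  exact ENNReal.ofReal_le_of_le_toReal h2

theorem lintegral_maxTruncRiesz_rpow_le {p q : ℝ} (hpq : p.HolderConjugate q) {K : NNReal}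
    (hK : ∀ g : ℝ → ℂ, Measurable g →
      ∫⁻ x : ℝ, hilbertMax g x ^ p ≤ K * ∫⁻ x, ‖g x‖ₑ ^ p)
    (hd : 0 < d) {f : 𝔼 → ℂ} (hfm : Measurable f) (hf : MemLp f (ENNReal.ofReal p) volume) :
    ∫⁻ x : 𝔼, maxTruncRiesz f x ^ p ≤
      ENNReal.ofReal (sphereConst p q) ^ p * (K * ∫⁻ x : 𝔼, ‖f x‖ₑ ^ p) := by
  have : Nonempty (Fin d) := ⟨⟨0, hd⟩⟩
  have hp := hpq.pos
  obtain ⟨v, hv⟩ := exists_norm_eq 𝔼 zero_le_one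
  set σ := (volume : Measure 𝔼).toSphere with hσ
  set c := ENNReal.ofReal (rieszC d) * sphereMoment q v ^ (1 / q) with hc
  have hm : Measurable fun q : 𝔼 × sphere (0 : 𝔼) 1 => dirMax f (q.2 : 𝔼) q.1 ^ p := by
    have h1 : Measurable fun q : 𝔼 × sphere (0 : 𝔼) 1 => ((q.2 : 𝔼), q.1) :=
      (measurable_subtype_coe.comp measurable_snd).prodMk measurable_fst
    exact ((measurable_dirMax hfm).comp h1).pow_const p
  calc ∫⁻ x : 𝔼, maxTruncRiesz f x ^ p
      ≤ ∫⁻ x : 𝔼, c ^ p * ∫⁻ θ : sphere (0 : 𝔼) 1, dirMax f θ x ^ p ∂σ := by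
        refine lintegral_mono fun x => ?_
        refine (ENNReal.rpow_le_rpow (maxTruncRiesz_le hpq hd hfm hf hv x) hp.le).trans
          (le_of_eq ?_)
        rw [← mul_assoc, ENNReal.mul_rpow_of_nonneg _ _ hp.le, ← ENNReal.rpow_mul,
          one_div_mul_cancel hp.ne', ENNReal.rpow_one]
    _ = c ^ p * ∫⁻ θ : sphere (0 : 𝔼) 1, (∫⁻ x : 𝔼, dirMax f θ x ^ p) ∂σ := by
        rw [lintegral_const_mul _ hm.lintegral_prod_right', lintegral_lintegral_swap]
        exact hm.aemeasurable
    _ ≤ c ^ p * ∫⁻ _ : sphere (0 : 𝔼) 1, (K * ∫⁻ x : 𝔼, ‖f x‖ₑ ^ p) ∂σ := by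
        refine mul_le_mul_right (lintegral_mono fun θ => ?_) _
        exact lintegral_dirMax_rpow_le hpq.lt hK hfm (by simp)
    _ = (c * σ univ ^ (1 / p)) ^ p * (K * ∫⁻ x : 𝔼, ‖f x‖ₑ ^ p) := by
        rw [lintegral_const, ENNReal.mul_rpow_of_nonneg c _ hp.le, ← ENNReal.rpow_mul (σ univ),
          one_div_mul_cancel hp.ne', ENNReal.rpow_one]
        ring
    _ ≤ _ := by
        gcongr
        rw [hc, mul_assoc]
        exact ofReal_rieszC_mul_le hd hpq hv

theorem eLpNorm_maxTruncRiesz_le {p q : ℝ} (hpq : p.HolderConjugate q) {K : NNReal}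
    (hK : ∀ g : ℝ → ℂ, Measurable g →
      ∫⁻ x : ℝ, hilbertMax g x ^ p ≤ K * ∫⁻ x, ‖g x‖ₑ ^ p)
    (hd : 0 < d) {f : 𝔼 → ℂ} (hfm : Measurable f) (hf : MemLp f (ENNReal.ofReal p) volume) :
    eLpNorm (maxTruncRiesz f) (ENNReal.ofReal p) volume ≤
      ENNReal.ofReal (sphereConst p q * (K : ℝ) ^ (1 / p)) *
        eLpNorm f (ENNReal.ofReal p) volume := by
  have hp := hpq.pos
  have hp' : ENNReal.ofReal p ≠ 0 := by simpa using hp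
  have hcast : ENNReal.ofReal (sphereConst p q * (K : ℝ) ^ (1 / p)) =
      ENNReal.ofReal (sphereConst p q) * (K : ℝ≥0∞) ^ (1 / p) := by
    rw [ENNReal.ofReal_mul (sphereConst_pos hpq.symm.pos).le,
      ← ENNReal.ofReal_rpow_of_nonneg K.coe_nonneg (by positivity), ENNReal.ofReal_coe_nnreal]
  rw [eLpNorm_eq_lintegral_rpow_enorm_toReal hp' ENNReal.ofReal_ne_top,
    eLpNorm_eq_lintegral_rpow_enorm_toReal hp' ENNReal.ofReal_ne_top,
    ENNReal.toReal_ofReal hp.le, hcast]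
  simp only [enorm_eq_self]
  refine (ENNReal.rpow_le_rpow (lintegral_maxTruncRiesz_rpow_le hpq hK hd hfm hf)
    (by positivity)).trans (le_of_eq ?_)
  rw [ENNReal.mul_rpow_of_nonneg _ _ (by positivity),
    ENNReal.mul_rpow_of_nonneg _ _ (by positivity), ← ENNReal.rpow_mul,
    mul_one_div_cancel hp.ne', ENNReal.rpow_one, mul_assoc]

end Maximal

end

end DimFreeRiesz

theorem mainTheorem4 (p : ℝ) (hp : 1 < p) :
    ∃ C : ℝ, 0 < C ∧
      ∀ d : ℕ, 1 ≤ d → ∀ f : EuclideanSpace ℝ (Fin d) → ℂ,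
        MemLp f (ENNReal.ofReal p) volume →
          (∀ (j : Fin d) (t : ℝ), 0 < t → ∀ x : EuclideanSpace ℝ (Fin d),
            IntegrableOn (rieszIntegrand j f x) {y | t < ‖x - y‖} volume) ∧
          MemLp (maxTruncRiesz f) (ENNReal.ofReal p) volume ∧
          eLpNorm (maxTruncRiesz f) (ENNReal.ofReal p) volume ≤
            ENNReal.ofReal C * eLpNorm f (ENNReal.ofReal p) volume := by
  have hpq := Real.HolderConjugate.conjExponent hp
  obtain ⟨K, hK0, hK⟩ := DimFreeRiesz.lintegral_hilbertMax_rpow_le hp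
  refine ⟨DimFreeRiesz.sphereConst p p.conjExponent * (K : ℝ) ^ (1 / p),
    mul_pos (DimFreeRiesz.sphereConst_pos hpq.symm.pos)
      (Real.rpow_pos_of_pos (NNReal.coe_pos.2 hK0) _), fun d hd f hf => ?_⟩
  refine ⟨fun j t ht x => DimFreeRiesz.integrableOn_rieszIntegrand hp ht hd hf j x, ?_⟩
  -- A measurable representative leaves the maximal function unchanged at every point, since each
  -- transform is an integral.
  obtain ⟨g, hgm, hfg⟩ := hf.1.aemeasurable
  have hg : MemLp g (ENNReal.ofReal p) volume := (memLp_congr_ae hfg).1 hf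
  have hbound := DimFreeRiesz.eLpNorm_maxTruncRiesz_le hpq hK hd hgm hg
  rw [DimFreeRiesz.maxTruncRiesz_congr hfg, eLpNorm_congr_ae hfg]
  refine ⟨⟨(DimFreeRiesz.measurable_maxTruncRiesz hp hd hgm hg).aestronglyMeasurable, ?_⟩, hbound⟩
  exact hbound.trans_lt (ENNReal.mul_lt_top ENNReal.ofReal_lt_top hg.2)
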